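/- Let $n\ge 1$, $m\in\mathbb R$, and let $P\in S^m$, i.e. $P:\mathbb R^n\to\mathbb C$ is infinitely differentiable and for every multi-index $\beta\in\mathbb Z_+^n$ there is $C_\beta>0$ with $|\partial^\beta P(\xi)|\le C_\beta(1+|\xi|)^{m-|\beta|}$ for all $\xi\in\mathbb R^n$. With $\widehat u(\xi)=\int_{\mathbb R^n}e^{-ix\cdot\xi}u(x)\,dx$, put $$Q(D)u(x)=(2\pi)^{-n}\int_{\mathbb R^n}e^{ix\cdot\xi}Q(\xi)\widehat u(\xi)\,d\xi,\qquad \|u\|_s=\Big((2\pi)^{-n}\int_{\mathbb R^n}(1+|\xi|^2)^s|\widehat u(\xi)|^2\,d\xi\Big)^{1/2}$$ for $Q=P$ or $Q=\partial^\alpha P$ and $s\in\mathbb R$. Let $\alpha\in\mathbb Z_+^n$ be a nonzero multi-index. (i) For all $s\in\mathbb R$, $\theta\ge 1$ and $\delta>0$ there are $\rho>0$ and $c>0$ such that, for every open set $\Omega\subset\mathbb R^n$ with $\operatorname{diam}(\Omega)<\rho$ and every $u\in C_0^\infty(\Omega)$, $$\|(\partial^\alpha P)(D)u\|_s\le\delta\,\|P(D)u\|_s+c\,\|u\|_{s+m-\theta}.$$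 (ii) For all $s,s'\in\mathbb R$ with $s'<s+m-|\alpha|$ and all $\delta>0$ there are $\rho>0$ and $c>0$ such that, for every open set $\Omega\subset\mathbb R^n$ with $\operatorname{diam}(\Omega)<\rho$ and every $u\in C_0^\infty(\Omega)$, $$\|(\partial^\alpha P)(D)u\|_s\le\delta\,\|P(D)u\|_s+c\,\|u\|_{s'}.$$ -/

import Mathlib

open MeasureTheory
open scoped ContDiff SchwartzMap FourierTransform

noncomputable section

namespace HormanderIneq

/-- Euclidean space `ℝⁿ`. -/
abbrev E (n : ℕ) : Type := EuclideanSpace ℝ (Fin n)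

/-- The partial derivative `∂_j f` of a function on `ℝⁿ`. -/
def pderiv {n : ℕ} (j : Fin n) (f : E n → ℂ) : E n → ℂ :=
  fun ξ ↦ fderiv ℝ f ξ (EuclideanSpace.single j 1)

/-- The partial derivative `∂^α f = ∂₁^{α₁} ⋯ ∂ₙ^{αₙ} f` for a multi-index `α`. -/
def multiDeriv {n : ℕ} (α : Fin n → ℕ) (f : E n → ℂ) : E n → ℂ :=
  (List.finRange n).foldr (fun j g ↦ (pderiv j)^[α j] g) f

/-- The symbol class `S^m` of `x`-independent symbols on `ℝⁿ`. -/
def IsSymbol {n : ℕ} (m : ℝ) (P : E n → ℂ) : Prop :=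
  ContDiff ℝ ∞ P ∧ ∀ α : Fin n → ℕ, ∃ c : ℝ, 0 < c ∧ ∀ ξ : E n,
    ‖multiDeriv α P ξ‖ ≤ c * (1 + ‖ξ‖) ^ (m - ((∑ j, α j : ℕ) : ℝ))

/-- The Fourier transform `û(ξ) = ∫ e^{-i x·ξ} u(x) dx`. -/
def ft {n : ℕ} (u : E n → ℂ) (ξ : E n) : ℂ :=
  ∫ x, Complex.exp (-Complex.I * (inner ℝ x ξ : ℝ)) * u x

/-- The operator `P(D)`, `P(D)u(x) = (2π)^{-n} ∫ e^{i x·ξ} P(ξ) û(ξ) dξ`, as a map of the Schwartz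
space to itself. Mathlib's Fourier transform has the kernel `e^{-2πi x·ξ}`, whence the factor `2π`
in the argument of `P`. The formula is proved in `psido_apply`; it applies to every symbol and to
its derivatives by `IsSymbol.hasTemperateGrowth` and `IsSymbol.multiDeriv`. -/
def psido {n : ℕ} (P : E n → ℂ) : 𝓢(E n, ℂ) →L[ℂ] 𝓢(E n, ℂ) :=
  SchwartzMap.fourierMultiplierCLM ℂ (fun ξ ↦ P ((2 * Real.pi) • ξ))

/-- The norm of the Sobolev space `H^s(ℝⁿ)`,
`‖u‖_s = ((2π)^{-n} ∫ (1 + |ξ|²)^s |û(ξ)|² dξ)^{1/2}`, on Schwartz functions, for which the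
integral converges (`integrable_sobolevNorm`). -/
def sobolevNorm {n : ℕ} (s : ℝ) (u : 𝓢(E n, ℂ)) : ℝ :=
  Real.sqrt (((2 * Real.pi) ^ n)⁻¹ * ∫ ξ : E n, (1 + ‖ξ‖ ^ 2) ^ s * ‖ft u ξ‖ ^ 2)

/-- The Schwartz function `u` is an element of `C_0^∞(Ω)`: its support is a compact subset
of `Ω`. (Every smooth function with compact support is a Schwartz function.) -/
def IsTest {n : ℕ} (Ω : Set (E n)) (u : 𝓢(E n, ℂ)) : Prop :=
  HasCompactSupport u ∧ tsupport u ⊆ Ω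

/-! Facts showing that `psido` is the operator given by the integral formula. -/

theorem contDiff_pderiv {n : ℕ} {f : E n → ℂ} (hf : ContDiff ℝ ∞ f) (j : Fin n) :
    ContDiff ℝ ∞ (pderiv j f) :=
  (hf.fderiv_right (m := ∞) (by simp)).clm_apply contDiff_const

theorem pderiv_comm {n : ℕ} {f : E n → ℂ} (hf : ContDiff ℝ ∞ f) (i j : Fin n) :
    pderiv i (pderiv j f) = pderiv j (pderiv i f) := by
  have h1 : Differentiable ℝ (fderiv ℝ f) :=
    (hf.fderiv_right (m := ∞) (by simp)).differentiable (by simp)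
  have key : ∀ (k l : Fin n) (ξ : E n), pderiv k (pderiv l f) ξ =
      fderiv ℝ (fderiv ℝ f) ξ (EuclideanSpace.single k 1) (EuclideanSpace.single l 1) := by
    intro k l ξ
    unfold pderiv
    rw [fderiv_clm_apply (h1 ξ) (differentiableAt_const _)]
    simp
  funext ξ
  rw [key, key]
  exact (hf.contDiffAt.isSymmSndFDerivAt
    (by simpa using WithTop.coe_le_coe.2 (le_top (a := (2 : ℕ∞))))) _ _

theorem contDiff_iterate {n : ℕ} {f : E n → ℂ} (hf : ContDiff ℝ ∞ f) (j : Fin n) (k : ℕ) :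
    ContDiff ℝ ∞ ((pderiv j)^[k] f) := by
  induction k with
  | zero => simpa using hf
  | succ k ih => rw [Function.iterate_succ_apply']; exact contDiff_pderiv ih j

theorem pderiv_iterate_comm {n : ℕ} {f : E n → ℂ} (hf : ContDiff ℝ ∞ f) (i j : Fin n) (k : ℕ) :
    pderiv i ((pderiv j)^[k] f) = (pderiv j)^[k] (pderiv i f) := by
  induction k with
  | zero => rfl
  | succ k ih =>
    rw [Function.iterate_succ_apply', Function.iterate_succ_apply',
      pderiv_comm (contDiff_iterate hf j k), ih]

theorem contDiff_foldr {n : ℕ} {f : E n → ℂ} (hf : ContDiff ℝ ∞ f) (α : Fin n → ℕ)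
    (l : List (Fin n)) : ContDiff ℝ ∞ (l.foldr (fun j g ↦ (pderiv j)^[α j] g) f) := by
  induction l with
  | nil => exact hf
  | cons a l ih => exact contDiff_iterate ih a (α a)

theorem contDiff_multiDeriv {n : ℕ} {f : E n → ℂ} (hf : ContDiff ℝ ∞ f) (α : Fin n → ℕ) :
    ContDiff ℝ ∞ (multiDeriv α f) :=
  contDiff_foldr hf α _

theorem multiDeriv_pderiv {n : ℕ} {f : E n → ℂ} (hf : ContDiff ℝ ∞ f) (α : Fin n → ℕ)
    (i : Fin n) : multiDeriv α (pderiv i f) = pderiv i (multiDeriv α f) := by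
  unfold multiDeriv
  induction (List.finRange n) with
  | nil => rfl
  | cons a l ih =>
    simp only [List.foldr_cons]
    rw [ih, pderiv_iterate_comm (contDiff_foldr hf α l)]

theorem pderiv_multiDeriv {n : ℕ} {f : E n → ℂ} (hf : ContDiff ℝ ∞ f) (α : Fin n → ℕ)
    (i : Fin n) : pderiv i (multiDeriv α f) = multiDeriv (α + Pi.single i 1) f := by
  have not_mem : ∀ l : List (Fin n), i ∉ l →
      l.foldr (fun j g ↦ (pderiv j)^[(α + Pi.single i 1 : Fin n → ℕ) j] g) f =
        l.foldr (fun j g ↦ (pderiv j)^[α j] g) f := by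
    intro l hl
    induction l with
    | nil => rfl
    | cons a l ih =>
      simp only [List.mem_cons, not_or] at hl
      simp only [List.foldr_cons]
      rw [ih hl.2]
      simp [Pi.single_eq_of_ne (Ne.symm hl.1)]
  have mem : ∀ l : List (Fin n), l.Nodup → i ∈ l →
      pderiv i (l.foldr (fun j g ↦ (pderiv j)^[α j] g) f) =
        l.foldr (fun j g ↦ (pderiv j)^[(α + Pi.single i 1 : Fin n → ℕ) j] g) f := by
    intro l hn hl
    induction l with
    | nil => simp at hl
    | cons a l ih =>
      rw [List.nodup_cons] at hn
      simp only [List.foldr_cons]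
      by_cases h : i = a
      · subst h
        rw [not_mem l hn.1, ← Function.iterate_succ_apply' (pderiv i)]
        simp
      · rw [pderiv_iterate_comm (contDiff_foldr hf α l), ih hn.2 (by simpa [h] using hl)]
        simp [Pi.single_eq_of_ne (Ne.symm h)]
  exact mem _ (List.nodup_finRange n) (List.mem_finRange i)

theorem multiDeriv_zero {n : ℕ} (f : E n → ℂ) : multiDeriv 0 f = f := by
  unfold multiDeriv
  induction (List.finRange n) with
  | nil => rfl
  | cons a l ih => simp

theorem IsSymbol.pderiv {n : ℕ} {m : ℝ} {P : E n → ℂ} (hP : IsSymbol m P) (i : Fin n) :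
    IsSymbol (m - 1) (pderiv i P) := by
  refine ⟨contDiff_pderiv hP.1 i, fun α ↦ ?_⟩
  obtain ⟨c, hc, h⟩ := hP.2 (α + Pi.single i 1)
  refine ⟨c, hc, fun ξ ↦ ?_⟩
  rw [multiDeriv_pderiv hP.1, pderiv_multiDeriv hP.1]
  have : (m - 1 - ((∑ j, α j : ℕ) : ℝ)) = m - ((∑ j, (α + Pi.single i 1 : Fin n → ℕ) j : ℕ) : ℝ) := by
    simp [Finset.sum_add_distrib, Pi.single_apply]
    ring
  rw [this]
  exact h ξ

theorem IsSymbol.multiDeriv {n : ℕ} {m : ℝ} {P : E n → ℂ} (hP : IsSymbol m P) (α : Fin n → ℕ) :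
    IsSymbol (m - ((∑ j, α j : ℕ) : ℝ)) (multiDeriv α P) := by
  induction hk : ∑ j, α j generalizing α with
  | zero =>
    have : α = 0 := by
      funext j
      simpa using (Finset.sum_eq_zero_iff.1 hk) j (Finset.mem_univ j)
    subst this
    simpa [multiDeriv_zero] using hP
  | succ k ih =>
    have : ∃ i, α i ≠ 0 := by
      by_contra! h
      simp [h] at hk
    obtain ⟨i, hi⟩ := this
    obtain ⟨β, rfl⟩ : ∃ β : Fin n → ℕ, α = β + Pi.single i 1 := by
      refine ⟨α - Pi.single i 1, funext fun j ↦ ?_⟩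
      by_cases h : j = i
      · subst h; simp; omega
      · simp [Pi.single_eq_of_ne h]
    have hβ : ∑ j, β j = k := by
      simpa [Finset.sum_add_distrib, Pi.single_apply] using hk
    rw [← pderiv_multiDeriv hP.1]
    have := (ih β hβ).pderiv i
    rwa [show m - ((k + 1 : ℕ) : ℝ) = m - (k : ℝ) - 1 by push_cast; ring]

theorem IsSymbol.hasTemperateGrowth {n : ℕ} {m : ℝ} {P : E n → ℂ} (hP : IsSymbol m P) :
    P.HasTemperateGrowth := by
  refine ⟨hP.1, fun k ↦ ?_⟩
  induction k generalizing P m with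
  | zero =>
    obtain ⟨c, hc, h⟩ := hP.2 0
    refine ⟨⌈m⌉₊, c, fun ξ ↦ ?_⟩
    rw [norm_iteratedFDeriv_zero]
    have h' := h ξ
    rw [multiDeriv_zero] at h'
    refine h'.trans ?_
    gcongr
    rw [← Real.rpow_natCast]
    apply Real.rpow_le_rpow_of_exponent_le
    · linarith [norm_nonneg ξ]
    · simpa using Nat.le_ceil m
  | succ k ih =>
    choose N C hNC using fun j : Fin n ↦ ih (hP.pderiv j)
    let L : Fin n → ℂ →L[ℝ] (E n →L[ℝ] ℂ) := fun j ↦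
      ContinuousLinearMap.smulRightL ℝ (E n) ℂ (EuclideanSpace.proj j)
    have hL : fderiv ℝ P = fun ξ ↦ ∑ j, L j (HormanderIneq.pderiv j P ξ) := by
      funext ξ
      ext v
      have hv : v = ∑ j, v j • EuclideanSpace.single j (1 : ℝ) := by
        ext i
        simp [Finset.sum_apply, Pi.single_apply]
      conv_lhs => rw [hv]
      simp [L, HormanderIneq.pderiv]
    refine ⟨∑ j, N j, ∑ j, ‖L j‖ * |C j|, fun ξ ↦ ?_⟩
    have hs : ∀ j, ContDiff ℝ ∞ (HormanderIneq.pderiv j P) := fun j ↦ contDiff_pderiv hP.1 j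
    rw [← norm_iteratedFDeriv_fderiv, hL,
      iteratedFDeriv_fun_sum_apply
        (f := fun j ξ ↦ L j (HormanderIneq.pderiv j P ξ)) (fun j _ ↦ (((L j).contDiff.comp (hs j)).of_le
        (by exact_mod_cast le_top)).contDiffAt), Finset.sum_mul]
    refine (norm_sum_le _ _).trans (Finset.sum_le_sum fun j _ ↦ ?_)
    refine ((L j).norm_iteratedFDeriv_comp_left (hs j).contDiffAt
      (by exact_mod_cast le_top)).trans ?_
    rw [mul_assoc]
    gcongr
    refine (hNC j ξ).trans ?_
    have h1 : (1 : ℝ) ≤ 1 + ‖ξ‖ := by linarith [norm_nonneg ξ]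
    gcongr
    · exact le_abs_self _
    · exact Finset.single_le_sum (f := N) (fun _ _ ↦ Nat.zero_le _) (Finset.mem_univ j)

theorem ft_eq {n : ℕ} (u : E n → ℂ) (ξ : E n) : ft u ((2 * Real.pi) • ξ) = 𝓕 u ξ := by
  rw [Real.fourier_eq', ft]
  congr 1
  funext x
  rw [inner_smul_right, smul_eq_mul]
  congr 2
  push_cast
  ring

/-- The operator `psido P` is given by the usual integral formula. -/
theorem psido_apply {n : ℕ} {P : E n → ℂ} (hP : P.HasTemperateGrowth) (u : 𝓢(E n, ℂ)) (x : E n) :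
    psido P u x = (((2 * Real.pi) ^ n)⁻¹ : ℝ) *
      ∫ ξ : E n, Complex.exp (Complex.I * (inner ℝ x ξ : ℝ)) * (P ξ * ft u ξ) := by
  have hP' : (fun ξ : E n ↦ P ((2 * Real.pi) • ξ)).HasTemperateGrowth :=
    hP.comp ((2 * Real.pi) • ContinuousLinearMap.id ℝ (E n)).hasTemperateGrowth
  have h := Measure.integral_comp_smul (volume : Measure (E n))
    (fun ξ ↦ Complex.exp (Complex.I * (inner ℝ x ξ : ℝ)) * (P ξ * ft u ξ)) (2 * Real.pi)
  rw [finrank_euclideanSpace_fin, abs_of_pos (by positivity)] at h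
  rw [← Complex.real_smul, ← h, psido, SchwartzMap.fourierMultiplierCLM_apply,
    SchwartzMap.fourierInv_coe, Real.fourierInv_eq']
  congr 1
  funext ξ
  rw [SchwartzMap.smulLeftCLM_apply_apply hP', ft_eq, SchwartzMap.fourier_coe, smul_eq_mul,
    smul_eq_mul, inner_smul_right, real_inner_comm]
  congr 2
  push_cast
  ring

/-- The integral in `sobolevNorm` converges. -/
theorem integrable_sobolevNorm {n : ℕ} (s : ℝ) (u : 𝓢(E n, ℂ)) :
    Integrable (fun ξ : E n ↦ (1 + ‖ξ‖ ^ 2) ^ s * ‖ft u ξ‖ ^ 2) := by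
  have hpi : (2 * Real.pi) ≠ 0 := by positivity
  let L : E n ≃L[ℝ] E n := ContinuousLinearEquiv.smulLeft (Units.mk0 _ (inv_ne_zero hpi))
  let w : E n → ℝ := fun ξ ↦ (1 + ‖ξ‖ ^ 2) ^ (s / 2)
  have hw : w.HasTemperateGrowth := Function.hasTemperateGrowth_one_add_norm_sq_rpow (E n) (s / 2)
  let g : 𝓢(E n, ℂ) := SchwartzMap.smulLeftCLM ℂ w
    (SchwartzMap.compCLMOfContinuousLinearEquiv ℝ L (𝓕 u))
  have hg : ∀ ξ, g ξ = w ξ • ft u ξ := by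
    intro ξ
    rw [SchwartzMap.smulLeftCLM_apply_apply hw, SchwartzMap.compCLMOfContinuousLinearEquiv_apply,
      Function.comp_apply, SchwartzMap.fourier_coe, ← ft_eq]
    congr 2
    exact smul_inv_smul₀ hpi ξ
  refine ((memLp_two_iff_integrable_sq_norm (g.memLp 2).1).1 (g.memLp 2)).congr
    (Filter.Eventually.of_forall fun ξ ↦ ?_)
  simp only [hg, norm_smul, mul_pow, Real.norm_eq_abs, sq_abs, w]
  rw [← Real.rpow_natCast, ← Real.rpow_mul (by positivity)]
  norm_num

end HormanderIneq

end

/-!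
The inequality is Hörmander's bound of `P^{(α)}(D)u` by `P(D)u` for `u` of small support, extended
from polynomials to symbols; the lower-order term absorbs whatever Taylor's formula leaves over.
It holds with a term `c ‖u‖_{s'}` for every real `s'`, so both parts of the theorem are instances
(`sobolevNorm_multiDeriv_le`), and applying it to one derivative at a time reduces `α` to a unit
vector `e_j`.

Put `q = (1 + |ξ|²)^{s/2} P`. As `∂_j (1 + |ξ|²)^{s/2}` is of lower order than the weight itself
(`norm_pderiv_bracket_mul_le`), it is enough to bound `‖(∂_j q) û‖` by `δ ‖q û‖` in `L²`. Suppose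
`|x_j - a| < ρ` on the support of `u`, let `ψ` be the identity on `(-ρ, ρ)` with `|ψ| ≤ 2ρ`, and
write `w = û`, `W` for the transform of `(x_j - a) u` and `κ = i / 2π`. Multiplication by
`ψ (x_j - a)` is a convolution in the variable `ξ_j`; Taylor's formula for `q` under that integral
shows that `ψ q(D) u` has the transform `q W + κ (∂_j q) w`, up to an error of arbitrarily low order
(`l2_commutator_le`), because `ψ' = 1` and `ψ'' = 0` on the support. Hence
`‖q W + κ (∂_j q) w‖ ≤ 2ρ ‖q w‖ + c ‖u‖_{s'}` (`l2_bernstein`), with `c` independent of `a`.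

Using this for `q` and for the conjugate of `∂_j q` in the energy identity (`l2_energy_le`) gives
`‖(∂_j q) w‖² ≤ C ‖q w‖ (ρ ‖(∂_j q) w‖ + ‖(∂_j² q) w‖)` up to lower-order terms. By induction
`‖(∂_j² q) w‖ ≤ δ ‖(∂_j q) w‖ + c ‖u‖_{s'}`; the induction starts at a derivative of `q` whose order
is at most `s'` (`l2_pderiv_le`).

Only derivatives in the direction `e_j` occur for fixed `j`, so that the symbol estimates are needed
in that direction alone (`DirSymbol`).
-/

noncomputable section

namespace HormanderIneq

/-! ### Directional symbols, weights and Taylor's formula -/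

theorem rpow_le_rpow_abs_mul_rpow {a b K : ℝ} (ha : 0 < a) (hb : 0 < b) (hK : 1 ≤ K)
    (hab : a ≤ K * b) (hba : b ≤ K * a) (m : ℝ) : a ^ m ≤ K ^ |m| * b ^ m := by
  have hK0 : 0 < K := by linarith
  rcases le_total 0 m with h | h
  · rw [abs_of_nonneg h, ← Real.mul_rpow hK0.le hb.le]
    exact Real.rpow_le_rpow ha.le hab h
  · have h1 : (K * a) ^ m ≤ b ^ m := Real.rpow_le_rpow_of_nonpos hb hba h
    rw [Real.mul_rpow hK0.le ha.le] at h1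
    calc a ^ m = K ^ |m| * (K ^ m * a ^ m) := by
          rw [abs_of_nonpos h, ← mul_assoc, ← Real.rpow_add hK0]; simp
      _ ≤ K ^ |m| * b ^ m := by gcongr

/-- Peetre's inequality. -/
theorem one_add_norm_rpow_le {V : Type*} [NormedAddCommGroup V] (m : ℝ) (x y : V) :
    (1 + ‖x‖) ^ m ≤ (1 + ‖x - y‖) ^ ⌈|m|⌉₊ * (1 + ‖y‖) ^ m := by
  have key : ∀ x y : V, 1 + ‖x‖ ≤ (1 + ‖x - y‖) * (1 + ‖y‖) := fun x y ↦ by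
    have := norm_sub_norm_le x y
    nlinarith [norm_nonneg x, norm_nonneg y, norm_nonneg (x - y)]
  have h1 : 1 ≤ 1 + ‖x - y‖ := by linarith [norm_nonneg (x - y)]
  refine (rpow_le_rpow_abs_mul_rpow (by positivity) (by positivity) h1 (key x y) ?_ m).trans ?_
  · rw [norm_sub_rev]; exact key y x
  · gcongr
    rw [← Real.rpow_natCast]
    exact Real.rpow_le_rpow_of_exponent_le h1 (Nat.le_ceil _)

/-- The unit vector `e_j` of `ℝⁿ`. -/
abbrev unitVec {n : ℕ} (j : Fin n) : E n := EuclideanSpace.single j 1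

theorem temperate_pderiv {n : ℕ} {q : E n → ℂ} (hq : q.HasTemperateGrowth) (j : Fin n) :
    (pderiv j q).HasTemperateGrowth := by
  have h : (fderiv ℝ q).HasTemperateGrowth := by
    refine ⟨hq.1.fderiv_right (m := ∞) (by simp), fun k ↦ ?_⟩
    obtain ⟨N, C, h⟩ := hq.2 (k + 1)
    exact ⟨N, C, fun x ↦ by rw [norm_iteratedFDeriv_fderiv]; exact h x⟩
  exact (((ContinuousLinearMap.apply ℝ ℂ (unitVec j)).hasTemperateGrowth).comp h)

/-- Symbols of order `m` in the direction `e_j`, with `K` derivatives: `∂_j^k q` is of temperate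
growth and `O((1 + |ξ|)^{m - k})` for every `k ≤ K`. The order of growth of the other
derivatives is left open. -/
def DirSymbol {n : ℕ} (j : Fin n) : ℕ → ℝ → (E n → ℂ) → Prop
  | 0, m, q => q.HasTemperateGrowth ∧ ∃ C : ℝ, 0 ≤ C ∧ ∀ ξ, ‖q ξ‖ ≤ C * (1 + ‖ξ‖) ^ m
  | K + 1, m, q => (q.HasTemperateGrowth ∧ ∃ C : ℝ, 0 ≤ C ∧ ∀ ξ, ‖q ξ‖ ≤ C * (1 + ‖ξ‖) ^ m) ∧
      DirSymbol j K (m - 1) (pderiv j q)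

namespace DirSymbol

variable {n : ℕ} {j : Fin n} {K : ℕ} {m m' : ℝ} {q r : E n → ℂ}

theorem zeroth (h : DirSymbol j K m q) : DirSymbol j 0 m q := by
  cases K with
  | zero => exact h
  | succ K => exact h.1

theorem temperate (h : DirSymbol j K m q) : q.HasTemperateGrowth := h.zeroth.1

theorem bound (h : DirSymbol j K m q) : ∃ C : ℝ, 0 ≤ C ∧ ∀ ξ, ‖q ξ‖ ≤ C * (1 + ‖ξ‖) ^ m :=
  h.zeroth.2

theorem pred (h : DirSymbol j (K + 1) m q) : DirSymbol j K m q := by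
  induction K generalizing m q with
  | zero => exact h.1
  | succ K ih => exact ⟨h.1, ih h.2⟩

theorem mono (h : DirSymbol j K m q) (hm : m ≤ m') : DirSymbol j K m' q := by
  have bd : ∀ {m m' : ℝ} {q : E n → ℂ}, m ≤ m' → DirSymbol j 0 m q → DirSymbol j 0 m' q := by
    rintro m m' q hm ⟨h, C, hC, h'⟩
    refine ⟨h, C, hC, fun ξ ↦ (h' ξ).trans ?_⟩
    gcongr
    linarith [norm_nonneg ξ]
  induction K generalizing m m' q with
  | zero => exact bd hm h
  | succ K ih => exact ⟨bd hm h.1, ih h.2 (by linarith)⟩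

theorem add (hq : DirSymbol j K m q) (hr : DirSymbol j K m r) :
    DirSymbol j K m (fun ξ ↦ q ξ + r ξ) := by
  have bd : ∀ {m : ℝ} {q r : E n → ℂ}, DirSymbol j 0 m q → DirSymbol j 0 m r →
      DirSymbol j 0 m (fun ξ ↦ q ξ + r ξ) := by
    rintro m q r ⟨hq, C, hC, h⟩ ⟨hr, C', hC', h'⟩
    refine ⟨hq.add hr, C + C', by positivity, fun ξ ↦ (norm_add_le _ _).trans ?_⟩
    rw [add_mul]
    exact add_le_add (h ξ) (h' ξ)
  induction K generalizing m q r with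
  | zero => exact bd hq hr
  | succ K ih =>
    refine ⟨bd hq.1 hr.1, ?_⟩
    have : pderiv j (fun ξ ↦ q ξ + r ξ) = fun ξ ↦ pderiv j q ξ + pderiv j r ξ := by
      funext ξ
      simp only [pderiv]
      rw [fderiv_fun_add (hq.temperate.1.differentiable (by simp) ξ)
        (hr.temperate.1.differentiable (by simp) ξ)]
      rfl
    rw [this]
    exact ih hq.2 hr.2

theorem _root_.HormanderIneq.pderiv_mul (hq : q.HasTemperateGrowth) (hr : r.HasTemperateGrowth) :
    pderiv j (fun ξ ↦ q ξ * r ξ) = fun ξ ↦ pderiv j q ξ * r ξ + q ξ * pderiv j r ξ := by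
  funext ξ
  simp only [pderiv]
  rw [fderiv_fun_mul (hq.1.differentiable (by simp) ξ) (hr.1.differentiable (by simp) ξ)]
  simp only [add_apply, smul_apply, smul_eq_mul]
  ring

theorem mul (hq : DirSymbol j K m q) (hr : DirSymbol j K m' r) :
    DirSymbol j K (m + m') (fun ξ ↦ q ξ * r ξ) := by
  have bd : ∀ {m m' : ℝ} {q r : E n → ℂ}, DirSymbol j 0 m q → DirSymbol j 0 m' r →
      DirSymbol j 0 (m + m') (fun ξ ↦ q ξ * r ξ) := by
    rintro m m' q r ⟨hq, C, hC, h⟩ ⟨hr, C', hC', h'⟩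
    refine ⟨hq.mul hr, C * C', by positivity, fun ξ ↦ ?_⟩
    rw [norm_mul, Real.rpow_add (by positivity)]
    calc _ ≤ (C * (1 + ‖ξ‖) ^ m) * (C' * (1 + ‖ξ‖) ^ m') :=
          mul_le_mul (h ξ) (h' ξ) (norm_nonneg _) (by positivity)
      _ = _ := by ring
  induction K generalizing m m' q r with
  | zero => exact bd hq hr
  | succ K ih =>
    refine ⟨bd hq.1 hr.1, ?_⟩
    rw [pderiv_mul hq.temperate hr.temperate]
    refine DirSymbol.add ?_ ?_
    · rw [show m + m' - 1 = m - 1 + m' by ring]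
      exact ih hq.2 hr.pred
    · rw [show m + m' - 1 = m + (m' - 1) by ring]
      exact ih hq.pred hr.2

theorem zero (m : ℝ) : DirSymbol j K m (fun _ ↦ 0) := by
  have bd : ∀ {m : ℝ}, DirSymbol j 0 m (fun _ ↦ 0) := fun {m} ↦
    ⟨.const 0, 0, le_rfl, fun ξ ↦ by simp⟩
  induction K generalizing m with
  | zero => exact bd
  | succ K ih =>
    refine ⟨bd, ?_⟩
    have : pderiv j (fun _ : E n ↦ (0 : ℂ)) = fun _ ↦ 0 := by
      funext ξ; simp [pderiv]
    rw [this]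
    exact ih _

theorem const (c : ℂ) : DirSymbol j K 0 (fun _ ↦ c) := by
  have bd : DirSymbol j 0 0 (fun _ ↦ c) := ⟨.const c, ‖c‖, norm_nonneg _, fun ξ ↦ by simp⟩
  cases K with
  | zero => exact bd
  | succ K =>
    refine ⟨bd, ?_⟩
    have : pderiv j (fun _ : E n ↦ c) = fun _ ↦ 0 := by
      funext ξ; simp [pderiv]
    rw [this]
    exact zero _

theorem _root_.HormanderIneq.pderiv_conj (hq : q.HasTemperateGrowth) :
    pderiv j (fun ξ ↦ starRingEnd ℂ (q ξ)) = fun ξ ↦ starRingEnd ℂ (pderiv j q ξ) := by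
  funext ξ
  have := ((Complex.conjCLE : ℂ →L[ℝ] ℂ).hasFDerivAt.comp ξ
    (hq.1.differentiable (by simp) ξ).hasFDerivAt).fderiv
  simp only [pderiv]
  erw [this]
  rfl

theorem conj (h : DirSymbol j K m q) : DirSymbol j K m (fun ξ ↦ starRingEnd ℂ (q ξ)) := by
  have bd : ∀ {m : ℝ} {q : E n → ℂ}, DirSymbol j 0 m q →
      DirSymbol j 0 m (fun ξ ↦ starRingEnd ℂ (q ξ)) := by
    rintro m q ⟨hq, C, hC, h⟩
    exact ⟨(Complex.conjCLE : ℂ →L[ℝ] ℂ).hasTemperateGrowth.comp hq, C, hC, fun ξ ↦ by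
      simpa using h ξ⟩
  induction K generalizing m q with
  | zero => exact bd h
  | succ K ih =>
    refine ⟨bd h.1, ?_⟩
    rw [pderiv_conj h.temperate]
    exact ih h.2

theorem coord : DirSymbol j K 1 (fun ξ ↦ (ξ j : ℂ)) := by
  have ht : (fun ξ : E n ↦ (ξ j : ℂ)).HasTemperateGrowth :=
    (Complex.ofRealCLM.comp (EuclideanSpace.proj j : E n →L[ℝ] ℝ)).hasTemperateGrowth
  have bd : DirSymbol j 0 1 (fun ξ : E n ↦ (ξ j : ℂ)) := by
    refine ⟨ht, 1, zero_le_one, fun ξ ↦ ?_⟩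
    have := PiLp.norm_apply_le ξ j
    simp only [Complex.norm_real, Real.rpow_one, one_mul]
    linarith
  cases K with
  | zero => exact bd
  | succ K =>
    refine ⟨bd, ?_⟩
    have : pderiv j (fun ξ : E n ↦ (ξ j : ℂ)) = fun _ ↦ 1 := by
      funext ξ
      have := (Complex.ofRealCLM.comp (EuclideanSpace.proj j : E n →L[ℝ] ℝ)).fderiv (x := ξ)
      simp only [pderiv]
      erw [this]
      simp
    rw [this, sub_self]
    exact const 1

end DirSymbol

/-- The weight `(1 + |ξ|²)^{s/2}`, as a complex-valued symbol. -/
def bracket {n : ℕ} (s : ℝ) (ξ : E n) : ℂ := (((1 + ‖ξ‖ ^ 2) ^ (s / 2) : ℝ) : ℂ)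

section bracket

variable {n : ℕ}

theorem norm_bracket (s : ℝ) (ξ : E n) : ‖bracket s ξ‖ = (1 + ‖ξ‖ ^ 2) ^ (s / 2) := by
  rw [bracket, Complex.norm_real, Real.norm_of_nonneg (by positivity)]

theorem bracket_add (s t : ℝ) (ξ : E n) : bracket (s + t) ξ = bracket s ξ * bracket t ξ := by
  simp only [bracket]
  rw [add_div, Real.rpow_add (by positivity)]
  push_cast
  ring

theorem norm_bracket_le (s : ℝ) : ∃ C : ℝ, 0 < C ∧
    ∀ ξ : E n, ‖bracket s ξ‖ ≤ C * (1 + ‖ξ‖) ^ s := by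
  refine ⟨2 ^ |s / 2|, by positivity, fun ξ ↦ ?_⟩
  rw [norm_bracket]
  have := rpow_le_rpow_abs_mul_rpow (a := 1 + ‖ξ‖ ^ 2) (b := (1 + ‖ξ‖) ^ 2) (K := 2) (by positivity)
    (by positivity) (by norm_num) (by nlinarith [norm_nonneg ξ]) (by nlinarith [sq_nonneg (1 - ‖ξ‖)])
    (s / 2)
  rw [← Real.rpow_natCast (1 + ‖ξ‖), ← Real.rpow_mul (by positivity)] at this
  convert this using 3
  push_cast; ring

theorem le_norm_bracket (s : ℝ) : ∃ C : ℝ, 0 < C ∧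
    ∀ ξ : E n, (1 + ‖ξ‖) ^ s ≤ C * ‖bracket s ξ‖ := by
  refine ⟨2 ^ |s / 2|, by positivity, fun ξ ↦ ?_⟩
  rw [norm_bracket]
  have := rpow_le_rpow_abs_mul_rpow (b := 1 + ‖ξ‖ ^ 2) (a := (1 + ‖ξ‖) ^ 2) (K := 2) (by positivity)
    (by positivity) (by norm_num) (by nlinarith [sq_nonneg (1 - ‖ξ‖)]) (by nlinarith [norm_nonneg ξ])
    (s / 2)
  rw [← Real.rpow_natCast (1 + ‖ξ‖), ← Real.rpow_mul (by positivity)] at this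
  convert this using 2
  push_cast; ring

theorem temperate_bracket (s : ℝ) : (bracket s : E n → ℂ).HasTemperateGrowth :=
  Function.HasTemperateGrowth.comp Function.Complex.hasTemperateGrowth_ofReal
    (Function.hasTemperateGrowth_one_add_norm_sq_rpow (E n) (s / 2))

theorem pderiv_bracket (j : Fin n) (s : ℝ) :
    pderiv j (bracket s) = fun ξ ↦ (s : ℂ) * ((ξ j : ℂ) * bracket (s - 2) ξ) := by
  funext ξ
  have h1 : HasFDerivAt (fun ξ : E n ↦ 1 + ‖ξ‖ ^ 2) (2 • innerSL ℝ ξ) ξ :=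
    (hasStrictFDerivAt_norm_sq ξ).hasFDerivAt.const_add 1
  have h2 := h1.rpow_const (p := s / 2) (Or.inl (by positivity))
  have h3 := (Complex.ofRealCLM.hasFDerivAt.comp ξ h2).fderiv
  simp only [pderiv]
  have h4 : bracket s = (Complex.ofRealCLM : ℝ → ℂ) ∘ fun ξ : E n ↦ (1 + ‖ξ‖ ^ 2) ^ (s / 2) := rfl
  rw [h4, h3]
  simp [bracket, PiLp.inner_apply, show (s - 2) / 2 = s / 2 - 1 by ring]
  ring

theorem dirSymbol_bracket (j : Fin n) (K : ℕ) (s : ℝ) : DirSymbol j K s (bracket s) := by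
  have bd : ∀ s, DirSymbol j 0 s (bracket s) := fun s ↦
    ⟨temperate_bracket s, let ⟨C, hC, h⟩ := norm_bracket_le s; ⟨C, hC.le, h⟩⟩
  induction K generalizing s with
  | zero => exact bd s
  | succ K ih =>
    refine ⟨bd s, ?_⟩
    rw [pderiv_bracket, show s - 1 = 0 + (1 + (s - 2)) by ring]
    exact (DirSymbol.const _).mul (DirSymbol.coord.mul (ih (s - 2)))

end bracket

theorem IsSymbol.dirSymbol {n : ℕ} {m : ℝ} {P : E n → ℂ} (hP : IsSymbol m P) (j : Fin n) (K : ℕ) :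
    DirSymbol j K m P := by
  have bd : ∀ {m : ℝ} {P : E n → ℂ}, IsSymbol m P → DirSymbol j 0 m P := by
    intro m P hP
    obtain ⟨c, hc, h⟩ := hP.2 0
    exact ⟨hP.hasTemperateGrowth, c, hc.le, by simpa [multiDeriv_zero] using h⟩
  induction K generalizing m P with
  | zero => exact bd hP
  | succ K ih => exact ⟨bd hP, ih (hP.pderiv j)⟩

/-- The dilation `ξ ↦ q(2πξ)`, which passes from the kernel `e^{-i x·ξ}` to Mathlib's
`e^{-2πi x·ξ}`. -/
def dil {n : ℕ} (q : E n → ℂ) (ξ : E n) : ℂ := q ((2 * Real.pi) • ξ)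

theorem temperate_dil {n : ℕ} {q : E n → ℂ} (hq : q.HasTemperateGrowth) :
    (dil q).HasTemperateGrowth :=
  hq.comp ((2 * Real.pi) • ContinuousLinearMap.id ℝ (E n)).hasTemperateGrowth

theorem pderiv_dil {n : ℕ} {q : E n → ℂ} (hq : q.HasTemperateGrowth) (j : Fin n) :
    pderiv j (dil q) = fun ξ ↦ ((2 * Real.pi : ℝ) : ℂ) * dil (pderiv j q) ξ := by
  funext ξ
  have h := ((hq.1.differentiable (by simp) ((2 * Real.pi) • ξ)).hasFDerivAt.comp ξ
    ((2 * Real.pi) • ContinuousLinearMap.id ℝ (E n)).hasFDerivAt).fderiv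
  simp only [pderiv]
  erw [h]
  simp [dil, pderiv]

theorem one_add_norm_smul_rpow_le {n : ℕ} (m : ℝ) (ξ : E n) :
    (1 + ‖(2 * Real.pi) • ξ‖) ^ m ≤ (2 * Real.pi) ^ |m| * (1 + ‖ξ‖) ^ m := by
  have hpi := Real.pi_gt_three
  have h0 := norm_nonneg ξ
  rw [norm_smul, Real.norm_of_nonneg (by positivity)]
  exact rpow_le_rpow_abs_mul_rpow (by positivity) (by positivity) (by linarith) (by nlinarith)
    (by nlinarith [mul_nonneg Real.pi_pos.le h0]) m

theorem le_one_add_norm_smul_rpow {n : ℕ} (m : ℝ) (ξ : E n) :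
    (1 + ‖ξ‖) ^ m ≤ (2 * Real.pi) ^ |m| * (1 + ‖(2 * Real.pi) • ξ‖) ^ m := by
  have hpi := Real.pi_gt_three
  have h0 := norm_nonneg ξ
  rw [norm_smul, Real.norm_of_nonneg (by positivity)]
  exact rpow_le_rpow_abs_mul_rpow (by positivity) (by positivity) (by linarith)
    (by nlinarith [mul_nonneg Real.pi_pos.le h0]) (by nlinarith) m

theorem DirSymbol.dil {n : ℕ} {j : Fin n} {K : ℕ} {m : ℝ} {q : E n → ℂ} (h : DirSymbol j K m q) :
    DirSymbol j K m (dil q) := by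
  have bd : ∀ {m : ℝ} {q : E n → ℂ}, DirSymbol j 0 m q → DirSymbol j 0 m (HormanderIneq.dil q) := by
    rintro m q ⟨hq, C, hC, h⟩
    refine ⟨temperate_dil hq, C * (2 * Real.pi) ^ |m|, by positivity, fun ξ ↦ (h _).trans ?_⟩
    rw [mul_assoc]
    gcongr
    exact one_add_norm_smul_rpow_le m ξ
  induction K generalizing m q with
  | zero => exact bd h
  | succ K ih =>
    refine ⟨bd h.1, ?_⟩
    rw [pderiv_dil h.temperate, ← zero_add (m - 1)]
    exact (DirSymbol.const _).mul (ih h.2)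

/-- Taylor's formula in the direction `e_j`, at the point `ξ - t e_j`. The remainder has the
order `m - N`, and by Peetre's inequality its weight may be taken at either end point. -/
theorem DirSymbol.taylor {n : ℕ} {j : Fin n} {N : ℕ} {m s : ℝ} {q : E n → ℂ}
    (h : DirSymbol j N m q) (hs : m - N ≤ s) : ∃ C : ℝ, ∃ A : ℕ, 0 ≤ C ∧ ∀ (ξ : E n) (t : ℝ),
      ‖q (ξ - t • unitVec j) -
        ∑ k ∈ Finset.range N, ((-t) ^ k / (k.factorial : ℝ) : ℝ) • ((pderiv j)^[k] q) ξ‖ ≤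
        C * (1 + |t|) ^ A * (1 + ‖ξ - t • unitVec j‖) ^ s := by
  have key : ∀ {N : ℕ} {m : ℝ} {q : E n → ℂ}, DirSymbol j N m q → ∃ C : ℝ, ∃ A : ℕ, 0 ≤ C ∧
      ∀ (ξ : E n) (t : ℝ), ‖q (ξ + t • unitVec j) -
        ∑ k ∈ Finset.range N, (t ^ k / (k.factorial : ℝ) : ℝ) • ((pderiv j)^[k] q) ξ‖ ≤
        C * (1 + |t|) ^ A * (1 + ‖ξ‖) ^ (m - N) := by
    intro N
    induction N with
    | zero =>
      intro m q h
      obtain ⟨C, hC, hb⟩ := h.bound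
      refine ⟨C, ⌈|m|⌉₊, hC, fun ξ t ↦ ?_⟩
      simp only [Finset.range_zero, Finset.sum_empty, sub_zero, Nat.cast_zero]
      refine (hb _).trans ?_
      rw [mul_assoc]
      gcongr
      simpa [norm_smul] using one_add_norm_rpow_le m (ξ + t • unitVec j) ξ
    | succ N ih =>
      intro m q h
      obtain ⟨C, A, hC, hb⟩ := ih h.2
      refine ⟨C, A + 1, hC, fun ξ t ↦ ?_⟩
      -- The remainder vanishes at `t = 0`, and its derivative is the remainder for `∂_j q`.
      let R : ℝ → ℂ := fun t ↦ q (ξ + t • unitVec j) -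
        ∑ k ∈ Finset.range (N + 1), (t ^ k / (k.factorial : ℝ) : ℝ) • ((pderiv j)^[k] q) ξ
      let R' : ℝ → ℂ := fun t ↦ pderiv j q (ξ + t • unitVec j) -
        ∑ k ∈ Finset.range N, (t ^ k / (k.factorial : ℝ) : ℝ) • ((pderiv j)^[k] (pderiv j q)) ξ
      have hR : ∀ t, HasDerivAt R (R' t) t := by
        intro t
        have h1 : HasDerivAt (fun t : ℝ ↦ q (ξ + t • unitVec j))
            (pderiv j q (ξ + t • unitVec j)) t := by
          have hl : HasDerivAt (fun t : ℝ ↦ ξ + t • unitVec j) (unitVec j) t := by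
            simpa using ((hasDerivAt_id t).smul_const (unitVec j)).const_add ξ
          exact (h.temperate.1.differentiable (by simp) _).hasFDerivAt.comp_hasDerivAt t hl
        have h2 : HasDerivAt (fun t : ℝ ↦ ∑ k ∈ Finset.range (N + 1),
            (t ^ k / (k.factorial : ℝ) : ℝ) • ((pderiv j)^[k] q) ξ)
            (∑ k ∈ Finset.range N,
              (t ^ k / (k.factorial : ℝ) : ℝ) • ((pderiv j)^[k] (pderiv j q)) ξ) t := by
          have h3 := HasDerivAt.fun_sum (u := Finset.range (N + 1)) fun k _ ↦
            ((hasDerivAt_pow k t).div_const (k.factorial : ℝ)).smul_const (((pderiv j)^[k] q) ξ)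
          refine h3.congr_deriv ?_
          rw [Finset.sum_range_succ']
          simp only [Nat.cast_zero, zero_mul, zero_div, zero_smul, add_zero]
          refine Finset.sum_congr rfl fun k _ ↦ ?_
          rw [Function.iterate_succ_apply]
          congr 1
          rw [Nat.factorial_succ]
          push_cast
          field_simp
        exact h1.sub h2
      have hR0 : R 0 = 0 := by
        simp [R, Finset.sum_range_succ']
      have := (convex_uIcc (0 : ℝ) t).norm_image_sub_le_of_norm_hasDerivWithin_le
        (f := R) (f' := R') (C := C * (1 + |t|) ^ A * (1 + ‖ξ‖) ^ (m - 1 - N))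
        (fun x _ ↦ (hR x).hasDerivWithinAt) (fun x hx ↦ ?_) Set.left_mem_uIcc Set.right_mem_uIcc
      · rw [hR0, sub_zero, sub_zero] at this
        refine this.trans ?_
        rw [Real.norm_eq_abs, show m - ((N + 1 : ℕ) : ℝ) = m - 1 - N by push_cast; ring, pow_succ]
        have h5 : 0 ≤ C * (1 + |t|) ^ A * (1 + ‖ξ‖) ^ (m - 1 - N) := by positivity
        nlinarith
      · refine (hb ξ x).trans ?_
        have hx' : |x| ≤ |t| := by
          simpa using Set.abs_sub_left_of_mem_uIcc hx
        gcongr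
  obtain ⟨C, A, hC, hb⟩ := key h
  refine ⟨C, A + ⌈|s|⌉₊, hC, fun ξ t ↦ ?_⟩
  have h1 := hb ξ (-t)
  rw [neg_smul, ← sub_eq_add_neg, abs_neg] at h1
  refine h1.trans ?_
  have h2 : (1 + ‖ξ‖) ^ (m - N) ≤ (1 + ‖ξ‖) ^ s :=
    Real.rpow_le_rpow_of_exponent_le (by linarith [norm_nonneg ξ]) hs
  have h3 := one_add_norm_rpow_le s ξ (ξ - t • unitVec j)
  simp only [sub_sub_cancel, norm_smul, Real.norm_eq_abs, PiLp.norm_single, abs_one,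
    mul_one] at h3
  rw [pow_add, ← mul_assoc, mul_assoc _ _ ((1 + ‖ξ - t • unitVec j‖) ^ s)]
  exact mul_le_mul_of_nonneg_left (h2.trans h3) (by positivity)

/-! ### The `L²` norm of Schwartz functions -/

section L2

variable {n : ℕ}

/-- The `L²` norm of a Schwartz function. -/
def l2 (f : 𝓢(E n, ℂ)) : ℝ := ‖f.toLp 2 volume‖

theorem l2_nonneg (f : 𝓢(E n, ℂ)) : 0 ≤ l2 f := norm_nonneg _

theorem toLp_add (f g : 𝓢(E n, ℂ)) : (f + g).toLp 2 volume = f.toLp 2 volume + g.toLp 2 volume := rfl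

theorem toLp_smul (c : ℂ) (f : 𝓢(E n, ℂ)) : (c • f).toLp 2 volume = c • f.toLp 2 volume := rfl

theorem l2_add_le (f g : 𝓢(E n, ℂ)) : l2 (f + g) ≤ l2 f + l2 g :=
  norm_add_le (f.toLp 2 volume) (g.toLp 2 volume)

theorem l2_smul (c : ℂ) (f : 𝓢(E n, ℂ)) : l2 (c • f) = ‖c‖ * l2 f :=
  norm_smul c (f.toLp 2 volume)

theorem l2_fourier (f : 𝓢(E n, ℂ)) : l2 (𝓕 f) = l2 f := SchwartzMap.norm_fourier_toL2_eq f

theorem l2_le_mul {c : ℝ} {f g : 𝓢(E n, ℂ)} (h : ∀ ξ, ‖f ξ‖ ≤ c * ‖g ξ‖) : l2 f ≤ c * l2 g := by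
  refine Lp.norm_le_mul_norm_of_ae_le_mul ?_
  filter_upwards [f.coeFn_toLp 2 volume, g.coeFn_toLp 2 volume] with x hf hg
  rw [hf, hg]
  exact h x

theorem l2_le {f g : 𝓢(E n, ℂ)} (h : ∀ ξ, ‖f ξ‖ ≤ ‖g ξ‖) : l2 f ≤ l2 g := by
  simpa using l2_le_mul (c := 1) (f := f) (g := g) (by simpa using h)

/-- The triangle inequality for a pointwise majorant. -/
theorem l2_le_add {a b : ℝ} (ha : 0 ≤ a) (hb : 0 ≤ b) {f g h : 𝓢(E n, ℂ)}
    (hf : ∀ ξ, ‖f ξ‖ ≤ a * ‖g ξ‖ + b * ‖h ξ‖) : l2 f ≤ a * l2 g + b * l2 h := by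
  -- Pass to `L²` functions, since `|g|` and `|h|` need not be smooth.
  have hg : MemLp (fun ξ ↦ a * ‖g ξ‖) 2 := (g.memLp 2).norm.const_mul a
  have hh : MemLp (fun ξ ↦ b * ‖h ξ‖) 2 := (h.memLp 2).norm.const_mul b
  have h1 : eLpNorm f 2 volume ≤ eLpNorm ((fun ξ ↦ a * ‖g ξ‖) + fun ξ ↦ b * ‖h ξ‖) 2 volume :=
    eLpNorm_mono_real hf
  have h2 := h1.trans (eLpNorm_add_le hg.1 hh.1 (by norm_num))
  have h3 : ∀ (c : ℝ), 0 ≤ c → ∀ k : 𝓢(E n, ℂ),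
      (eLpNorm (fun ξ ↦ c * ‖k ξ‖) 2 volume).toReal = c * l2 k := by
    intro c hc k
    have : (fun ξ ↦ c * ‖k ξ‖) = c • fun ξ ↦ ‖k ξ‖ := rfl
    rw [this, eLpNorm_const_smul, eLpNorm_norm, ENNReal.toReal_mul, l2, SchwartzMap.norm_toLp,
      toReal_enorm, Real.norm_of_nonneg hc]
  have h4 := ENNReal.toReal_mono (ENNReal.add_ne_top.2 ⟨hg.2.ne, hh.2.ne⟩) h2
  rwa [ENNReal.toReal_add hg.2.ne hh.2.ne, h3 a ha, h3 b hb, ← SchwartzMap.norm_toLp] at h4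

theorem inner_toLp_congr {f g f' g' : 𝓢(E n, ℂ)}
    (h : ∀ ξ, starRingEnd ℂ (f ξ) * g ξ = starRingEnd ℂ (f' ξ) * g' ξ) :
    inner ℂ (f.toLp 2 volume) (g.toLp 2 volume) = inner ℂ (f'.toLp 2 volume) (g'.toLp 2 volume) := by
  rw [SchwartzMap.inner_toL2_toL2_eq f g volume, SchwartzMap.inner_toL2_toL2_eq f' g' volume]
  congr 1
  funext ξ
  simp only [RCLike.inner_apply']
  exact h ξ

theorem l2_sq (f : 𝓢(E n, ℂ)) : l2 f ^ 2 = ∫ ξ, ‖f ξ‖ ^ 2 := by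
  have h := inner_self_eq_norm_sq_to_K (𝕜 := ℂ) (f.toLp 2 volume)
  rw [SchwartzMap.inner_toL2_toL2_eq f f volume] at h
  simp only [inner_self_eq_norm_sq_to_K] at h
  have h' : ((∫ ξ, ‖f ξ‖ ^ 2 : ℝ) : ℂ) = ((l2 f ^ 2 : ℝ) : ℂ) := by
    rw [← integral_complex_ofReal]
    simpa [l2] using h
  exact_mod_cast h'.symm

theorem ofReal_l2_sq (f : 𝓢(E n, ℂ)) : ENNReal.ofReal (l2 f ^ 2) = ∫⁻ ξ, ‖f ξ‖ₑ ^ 2 := by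
  rw [l2_sq, ofReal_integral_eq_lintegral_ofReal]
  · congr 1
    funext ξ
    rw [ENNReal.ofReal_pow (norm_nonneg _), ofReal_norm]
  · exact (memLp_two_iff_integrable_sq_norm (f.memLp 2).1).1 (f.memLp 2)
  · exact Filter.Eventually.of_forall fun ξ ↦ by positivity

/-- Young's inequality for the convolution along a line with an integrable kernel. -/
theorem l2_le_of_le_integral {k : ℝ → ℝ} (hk : Integrable k) (hk0 : ∀ t, 0 ≤ k t)
    (hkm : Continuous k) (e : E n) {f g : 𝓢(E n, ℂ)}
    (h : ∀ ξ, ‖f ξ‖ ≤ ∫ t, k t * ‖g (ξ - t • e)‖) : l2 f ≤ (∫ t, k t) * l2 g := by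
  have hI : 0 ≤ ∫ t, k t := integral_nonneg hk0
  have hK : ∫⁻ t, ENNReal.ofReal (k t) = ENNReal.ofReal (∫ t, k t) :=
    (ofReal_integral_eq_lintegral_ofReal hk (Filter.Eventually.of_forall hk0)).symm
  have hgm : Measurable fun p : E n × ℝ ↦ ‖g (p.1 - p.2 • e)‖ₑ := by
    have : Continuous fun p : E n × ℝ ↦ g (p.1 - p.2 • e) := g.continuous.comp (by fun_prop)
    exact this.enorm.measurable
  have hpt : ∀ ξ, ‖f ξ‖ₑ ^ 2 ≤ ENNReal.ofReal (∫ t, k t) *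
      ∫⁻ t, ENNReal.ofReal (k t) * ‖g (ξ - t • e)‖ₑ ^ 2 := by
    intro ξ
    have hgx : Measurable fun t : ℝ ↦ ‖g (ξ - t • e)‖ₑ := by
      have : Continuous fun t : ℝ ↦ g (ξ - t • e) := g.continuous.comp (by fun_prop)
      exact this.enorm.measurable
    have h1 : ‖f ξ‖ₑ ≤ ∫⁻ t, ENNReal.ofReal (k t) * ‖g (ξ - t • e)‖ₑ := by
      rw [← ofReal_norm]
      refine (ENNReal.ofReal_le_ofReal (h ξ)).trans ?_
      refine (ENNReal.ofReal_le_ofReal (le_abs_self _)).trans ?_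
      rw [← Real.norm_eq_abs, ofReal_norm]
      refine (enorm_integral_le_lintegral_enorm _).trans (le_of_eq ?_)
      congr 1
      funext t
      rw [enorm_mul, enorm_norm, Real.enorm_of_nonneg (hk0 t)]
    -- Cauchy--Schwarz with respect to the measure `k(t) dt`.
    have h2 := ENNReal.lintegral_mul_le_Lp_mul_Lq volume Real.HolderConjugate.two_two
      (f := fun t ↦ ENNReal.ofReal (k t) ^ (1 / 2 : ℝ))
      (g := fun t ↦ ENNReal.ofReal (k t) ^ (1 / 2 : ℝ) * ‖g (ξ - t • e)‖ₑ)
      (hkm.measurable.ennreal_ofReal.pow_const _).aemeasurable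
      ((hkm.measurable.ennreal_ofReal.pow_const _).mul hgx).aemeasurable
    have h3 : ∀ x : ENNReal, (x ^ (1 / 2 : ℝ)) ^ (2 : ℝ) = x := fun x ↦ by
      rw [← ENNReal.rpow_mul]; norm_num
    have h4 : ∀ x : ENNReal, x ^ (1 / 2 : ℝ) * x ^ (1 / 2 : ℝ) = x := fun x ↦ by
      rw [← ENNReal.rpow_add_of_nonneg _ _ (by norm_num) (by norm_num)]; norm_num
    simp only [Pi.mul_apply, ← mul_assoc, h4, h3, ENNReal.mul_rpow_of_nonneg _ _
      (show (0 : ℝ) ≤ 2 by norm_num)] at h2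
    have h5 := ENNReal.rpow_le_rpow (h1.trans h2) (show (0 : ℝ) ≤ 2 by norm_num)
    rw [ENNReal.mul_rpow_of_nonneg _ _ (by norm_num), h3, h3, hK] at h5
    simpa [ENNReal.rpow_two] using h5
  have hsq : ENNReal.ofReal (l2 f ^ 2) ≤ ENNReal.ofReal (((∫ t, k t) * l2 g) ^ 2) := by
    rw [ofReal_l2_sq]
    refine (lintegral_mono hpt).trans ?_
    rw [lintegral_const_mul' _ _ ENNReal.ofReal_ne_top, lintegral_lintegral_swap]
    · have : ∀ t : ℝ, ∫⁻ ξ : E n, ENNReal.ofReal (k t) * ‖g (ξ - t • e)‖ₑ ^ 2 =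
          ENNReal.ofReal (k t) * ENNReal.ofReal (l2 g ^ 2) := by
        intro t
        rw [lintegral_const_mul' _ _ ENNReal.ofReal_ne_top,
          lintegral_sub_right_eq_self (fun ξ ↦ ‖g ξ‖ₑ ^ 2) (t • e), ofReal_l2_sq]
      simp only [this]
      rw [lintegral_mul_const' _ _ ENNReal.ofReal_ne_top, hK, ← ENNReal.ofReal_mul hI,
        ← ENNReal.ofReal_mul hI]
      apply le_of_eq
      congr 1
      ring
    · exact ((hkm.measurable.ennreal_ofReal.comp measurable_snd).mul (hgm.pow_const 2)).aemeasurable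
  rw [ENNReal.ofReal_le_ofReal_iff (by positivity)] at hsq
  exact (sq_le_sq₀ (l2_nonneg _) (mul_nonneg hI (l2_nonneg _))).1 hsq

end L2

/-! ### Multiplication by functions of one coordinate -/

section Line

variable {n : ℕ}

/-- Convolution in the direction `e_j` with the Fourier transform of `t ↦ ψ (t - a)`. -/
def lineConv (j : Fin n) (ψ : 𝓢(ℝ, ℂ)) (a : ℝ) (f : E n → ℂ) (ξ : E n) : ℂ :=
  ∫ t : ℝ, Complex.exp ((-(2 * Real.pi * a * t) : ℝ) * Complex.I) * 𝓕 ψ t * f (ξ - t • unitVec j)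

theorem temperate_comp_coord (j : Fin n) (ψ : 𝓢(ℝ, ℂ)) (a : ℝ) :
    (fun x : E n ↦ ψ (x j - a)).HasTemperateGrowth := by
  have h : (fun x : E n ↦ x j - a).HasTemperateGrowth :=
    ((EuclideanSpace.proj j : E n →L[ℝ] ℝ).hasTemperateGrowth).sub (.const a)
  exact ψ.hasTemperateGrowth.comp h

/-- Multiplication by `ψ (x_j - a)`. -/
def cutoff (j : Fin n) (ψ : 𝓢(ℝ, ℂ)) (a : ℝ) : 𝓢(E n, ℂ) →L[ℂ] 𝓢(E n, ℂ) :=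
  SchwartzMap.smulLeftCLM ℂ fun x ↦ ψ (x j - a)

theorem cutoff_apply (j : Fin n) (ψ : 𝓢(ℝ, ℂ)) (a : ℝ) (f : 𝓢(E n, ℂ)) (x : E n) :
    cutoff j ψ a f x = ψ (x j - a) * f x := by
  rw [cutoff, SchwartzMap.smulLeftCLM_apply_apply (temperate_comp_coord j ψ a), smul_eq_mul]

/-- On the Fourier side, multiplication by `ψ (x_j - a)` is convolution in the direction `e_j`. -/
theorem fourier_cutoff (j : Fin n) (ψ : 𝓢(ℝ, ℂ)) (a : ℝ) (g : 𝓢(E n, ℂ)) (ξ : E n) :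
    𝓕 (cutoff j ψ a g) ξ = lineConv j ψ a (𝓕 g : 𝓢(E n, ℂ)) ξ := by
  have hψ : ∀ y : ℝ, ψ y = ∫ t : ℝ, Complex.exp ((2 * Real.pi * (t * y) : ℝ) * Complex.I) * 𝓕 ψ t := by
    intro y
    have h := congrArg (fun φ : 𝓢(ℝ, ℂ) ↦ φ y) (FourierTransform.fourierInv_fourier_eq (F := 𝓢(ℝ, ℂ)) ψ)
    simp only [SchwartzMap.fourierInv_coe, Real.fourierInv_eq'] at h
    rw [← h]
    simp [mul_comm]
  have hsw : Integrable (Function.uncurry fun (x : E n) (t : ℝ) ↦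
      Complex.exp ((-(2 * Real.pi * inner ℝ x ξ) : ℝ) * Complex.I) *
        (Complex.exp ((2 * Real.pi * (t * (x j - a)) : ℝ) * Complex.I) * 𝓕 ψ t) * g x)
      ((volume : Measure (E n)).prod (volume : Measure ℝ)) := by
    have h0 := g.integrable.mul_prod (𝓕 ψ).integrable (μ := volume) (ν := volume)
    refine h0.norm.mono' ?_ (Filter.Eventually.of_forall fun p ↦ ?_)
    · have hc : Continuous (Function.uncurry fun (x : E n) (t : ℝ) ↦
        Complex.exp ((-(2 * Real.pi * inner ℝ x ξ) : ℝ) * Complex.I) *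
        (Complex.exp ((2 * Real.pi * (t * (x j - a)) : ℝ) * Complex.I) * 𝓕 ψ t) * g x) := by
        have h1 := g.continuous
        have h2 := (𝓕 ψ).continuous
        simp only [Function.uncurry_def]
        fun_prop
      exact hc.aestronglyMeasurable
    · simp only [Function.uncurry, norm_mul, Complex.norm_exp_ofReal_mul_I, one_mul]
      rw [mul_comm]
  rw [SchwartzMap.fourier_coe (cutoff j ψ a g), Real.fourier_eq']
  calc _ = ∫ x : E n, ∫ t : ℝ, Complex.exp ((-(2 * Real.pi * inner ℝ x ξ) : ℝ) * Complex.I) *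
        (Complex.exp ((2 * Real.pi * (t * (x j - a)) : ℝ) * Complex.I) * 𝓕 ψ t) * g x := by
        congr 1
        funext x
        rw [integral_mul_const, integral_const_mul, ← hψ, cutoff_apply, smul_eq_mul, mul_assoc]
        simp [mul_assoc]
    _ = _ := by
        rw [integral_integral_swap hsw, lineConv]
        congr 1
        funext t
        rw [SchwartzMap.fourier_coe g, Real.fourier_eq', ← integral_const_mul]
        congr 1
        funext x
        have hexp : Complex.exp ((-(2 * Real.pi * inner ℝ x ξ) : ℝ) * Complex.I) *
            Complex.exp ((2 * Real.pi * (t * (x j - a)) : ℝ) * Complex.I) =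
            Complex.exp ((-(2 * Real.pi * a * t) : ℝ) * Complex.I) *
            Complex.exp ((-2 * Real.pi * inner ℝ x (ξ - t • unitVec j) : ℝ) * Complex.I) := by
          rw [← Complex.exp_add, ← Complex.exp_add, ← add_mul, ← add_mul, ← Complex.ofReal_add,
            ← Complex.ofReal_add, inner_sub_right, inner_smul_right,
            EuclideanSpace.inner_single_right]
          congr 3
          simp only [conj_trivial, one_mul]
          ring
        rw [smul_eq_mul]
        linear_combination (𝓕 ψ t * g x) * hexp

end Line

/-! ### The commutator of a multiplier with a function of one coordinate -/

section Commutator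

variable {n : ℕ}

/-- Multiplication of a Schwartz function by `q`. -/
abbrev mulS (q : E n → ℂ) : 𝓢(E n, ℂ) →L[ℂ] 𝓢(E n, ℂ) := SchwartzMap.smulLeftCLM ℂ q

theorem mulS_apply {q : E n → ℂ} (hq : q.HasTemperateGrowth) (f : 𝓢(E n, ℂ)) (ξ : E n) :
    mulS q f ξ = q ξ * f ξ :=
  SchwartzMap.smulLeftCLM_apply_apply hq f ξ

theorem integrable_one_add_abs_pow_mul (A : ℕ) (φ : 𝓢(ℝ, ℂ)) :
    Integrable fun t : ℝ ↦ (1 + |t|) ^ A * ‖φ t‖ := by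
  have h : (fun t : ℝ ↦ (1 + |t|) ^ A * ‖φ t‖) =
      fun t ↦ ∑ i ∈ Finset.range (A + 1), (A.choose i : ℝ) * (‖t‖ ^ i * ‖φ t‖) := by
    funext t
    rw [add_comm, add_pow, Finset.sum_mul]
    refine Finset.sum_congr rfl fun i _ ↦ ?_
    rw [one_pow, Real.norm_eq_abs]
    ring
  rw [h]
  exact integrable_finsetSum _ fun i _ ↦ (φ.integrable_pow_mul volume i).const_mul _

theorem exists_bound (f : 𝓢(E n, ℂ)) : ∃ C, ∀ ξ, ‖f ξ‖ ≤ C :=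
  ⟨_, SchwartzMap.norm_le_seminorm ℝ f⟩

theorem continuous_line (f : 𝓢(E n, ℂ)) (ξ e : E n) : Continuous fun t : ℝ ↦ f (ξ - t • e) :=
  f.continuous.comp (by fun_prop)

theorem integrable_lineConv (j : Fin n) (ψ : 𝓢(ℝ, ℂ)) (a : ℝ) (f : 𝓢(E n, ℂ)) (ξ : E n) :
    Integrable fun t : ℝ ↦ Complex.exp ((-(2 * Real.pi * a * t) : ℝ) * Complex.I) * 𝓕 ψ t *
      f (ξ - t • unitVec j) := by
  obtain ⟨C, hC⟩ := exists_bound f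
  refine ((𝓕 ψ).integrable.norm.mul_const C).mono' ?_ (Filter.Eventually.of_forall fun t ↦ ?_)
  · have h1 := continuous_line f ξ (unitVec j)
    have h2 := (𝓕 ψ).continuous
    have h3 : Continuous fun t : ℝ ↦
      Complex.exp ((-(2 * Real.pi * a * t) : ℝ) * Complex.I) * 𝓕 ψ t * f (ξ - t • unitVec j) :=
      ((by fun_prop : Continuous fun t : ℝ ↦
        Complex.exp ((-(2 * Real.pi * a * t) : ℝ) * Complex.I)).mul h2).mul h1
    exact h3.aestronglyMeasurable
  · rw [norm_mul, norm_mul, Complex.norm_exp_ofReal_mul_I, one_mul]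
    gcongr
    exact hC _

/-- The `k`-th derivative of a Schwartz function on the line. -/
abbrev derivS (k : ℕ) (ψ : 𝓢(ℝ, ℂ)) : 𝓢(ℝ, ℂ) := (SchwartzMap.derivCLM ℂ ℂ)^[k] ψ

theorem fourier_derivS (k : ℕ) (ψ : 𝓢(ℝ, ℂ)) (t : ℝ) :
    𝓕 (derivS k ψ) t = (2 * Real.pi * Complex.I * t) ^ k * 𝓕 ψ t := by
  induction k with
  | zero => rw [pow_zero, one_mul]; rfl
  | succ k ih =>
    rw [derivS, Function.iterate_succ_apply', SchwartzMap.fourier_coe]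
    have h : ⇑(SchwartzMap.derivCLM ℂ ℂ (derivS k ψ)) = deriv (derivS k ψ) := rfl
    rw [h, Real.fourier_deriv (derivS k ψ).integrable (derivS k ψ).differentiable
      (SchwartzMap.derivCLM ℂ ℂ (derivS k ψ)).integrable]
    simp only [smul_eq_mul]
    rw [← SchwartzMap.fourier_coe, ih]
    ring

/-- The constant `i / 2π`, by which `∂_{ξ_j}` corresponds to multiplication by `x_j`. -/
def kap : ℂ := Complex.I / (2 * Real.pi)

theorem norm_kap : ‖kap‖ = (2 * Real.pi)⁻¹ := by
  rw [kap, norm_div, Complex.norm_I, one_div, norm_mul, Complex.norm_real,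
    Real.norm_of_nonneg Real.pi_pos.le]
  simp

theorem kap_mul (t : ℝ) : kap * (2 * Real.pi * Complex.I * t) = ((-t : ℝ) : ℂ) := by
  have hpi : (Real.pi : ℂ) ≠ 0 := Complex.ofReal_ne_zero.2 Real.pi_ne_zero
  rw [kap]
  push_cast
  field_simp
  linear_combination (t : ℂ) * Complex.I_sq

/-- The expansion of the commutator of the multiplier `q(D)` with multiplication by
`ψ (x_j - a)`, uniformly in `a`: up to an error of order `m - N`,
`ψ q(D) u = ∑_{k < N} (κ^k / k!) (∂_j^k q)(D) (ψ^{(k)} u)`. On the Fourier side this is Taylor's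
formula under the integral that defines the convolution. -/
theorem l2_commutator_le {j : Fin n} {N : ℕ} {m s : ℝ} {q : E n → ℂ}
    (hq : ∀ K, DirSymbol j K m q) (hs : m - N ≤ s) (ψ : 𝓢(ℝ, ℂ)) :
    ∃ c : ℝ, 0 ≤ c ∧ ∀ (u : 𝓢(E n, ℂ)) (a : ℝ),
      l2 (𝓕 (cutoff j ψ a (𝓕⁻ (mulS q (𝓕 u)))) -
        ∑ k ∈ Finset.range N, (kap ^ k / (k.factorial : ℂ)) •
          mulS ((pderiv j)^[k] q) (𝓕 (cutoff j (derivS k ψ) a u))) ≤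
        c * l2 (mulS (bracket s) (𝓕 u)) := by
  obtain ⟨C, A, hC, hT⟩ := (hq N).taylor hs
  obtain ⟨C', hC', hB⟩ := le_norm_bracket (n := n) s
  have hqk : ∀ k, ((pderiv j)^[k] q).HasTemperateGrowth := by
    intro k
    induction k with
    | zero => exact (hq 0).temperate
    | succ k ih => rw [Function.iterate_succ_apply']; exact temperate_pderiv ih j
  let k : ℝ → ℝ := fun t ↦ C * C' * ((1 + |t|) ^ A * ‖𝓕 ψ t‖)
  have hk : Integrable k := (integrable_one_add_abs_pow_mul A (𝓕 ψ)).const_mul _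
  have hk0 : ∀ t, 0 ≤ k t := fun t ↦ by positivity
  have hkc : Continuous k := by
    have h2 := (𝓕 ψ).continuous
    exact continuous_const.mul (((by fun_prop : Continuous fun t : ℝ ↦ (1 + |t|) ^ A)).mul h2.norm)
  refine ⟨∫ t, k t, integral_nonneg hk0, fun u a ↦
    l2_le_of_le_integral hk hk0 hkc (unitVec j) fun ξ ↦ ?_⟩
  set w := 𝓕 u with hw
  let ex : ℝ → ℂ := fun t ↦ Complex.exp ((-(2 * Real.pi * a * t) : ℝ) * Complex.I)
  have e1 : (𝓕 (cutoff j ψ a (𝓕⁻ (mulS q w))) -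
        ∑ k ∈ Finset.range N, (kap ^ k / (k.factorial : ℂ)) •
          mulS ((pderiv j)^[k] q) (𝓕 (cutoff j (derivS k ψ) a u))) ξ =
      ∫ t : ℝ, ex t * 𝓕 ψ t * ((q (ξ - t • unitVec j) -
        ∑ k ∈ Finset.range N, ((-t) ^ k / (k.factorial : ℝ) : ℝ) • ((pderiv j)^[k] q) ξ) *
          w (ξ - t • unitVec j)) := by
    have h1 : 𝓕 (cutoff j ψ a (𝓕⁻ (mulS q w))) ξ =
        ∫ t : ℝ, ex t * 𝓕 ψ t * mulS q w (ξ - t • unitVec j) := by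
      rw [fourier_cutoff, FourierTransform.fourier_fourierInv_eq (F := 𝓢(E n, ℂ))]
      rfl
    have h2 : ∀ k : ℕ, ((kap ^ k / (k.factorial : ℂ)) •
        mulS ((pderiv j)^[k] q) (𝓕 (cutoff j (derivS k ψ) a u))) ξ =
        ∫ t : ℝ, (kap ^ k / (k.factorial : ℂ) * ((pderiv j)^[k] q) ξ) *
          (ex t * 𝓕 (derivS k ψ) t * w (ξ - t • unitVec j)) := by
      intro k
      rw [smul_apply, mulS_apply (hqk k), fourier_cutoff, integral_const_mul,
        smul_eq_mul, mul_assoc]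
      rfl
    rw [sub_apply, sum_apply, h1, Finset.sum_congr rfl fun k _ ↦ h2 k,
      ← integral_finsetSum _ fun k _ ↦ (integrable_lineConv j (derivS k ψ) a w ξ).const_mul _,
      ← integral_sub (integrable_lineConv j ψ a (mulS q w) ξ)
        (integrable_finsetSum _ fun k _ ↦
          (integrable_lineConv j (derivS k ψ) a w ξ).const_mul _)]
    congr 1
    funext t
    rw [mulS_apply (hq 0).temperate, sub_mul, mul_sub, Finset.sum_mul, Finset.mul_sum]
    congr 1
    refine Finset.sum_congr rfl fun k _ ↦ ?_
    have h3 : kap ^ k * (2 * Real.pi * Complex.I * t) ^ k = ((-t : ℝ) : ℂ) ^ k := by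
      rw [← mul_pow, kap_mul]
    rw [fourier_derivS, Complex.real_smul]
    simp only [ex]
    push_cast at h3 ⊢
    rw [← h3]
    ring
  rw [e1]
  obtain ⟨D, hD⟩ := exists_bound (mulS (bracket s) w)
  refine norm_integral_le_of_norm_le ?_ (Filter.Eventually.of_forall fun t ↦ ?_)
  · refine (hk.mul_const D).mono'
      (hkc.mul (continuous_line _ ξ _).norm).aestronglyMeasurable
      (Filter.Eventually.of_forall fun t ↦ ?_)
    rw [Real.norm_of_nonneg (mul_nonneg (hk0 t) (norm_nonneg _))]
    exact mul_le_mul_of_nonneg_left (hD _) (hk0 t)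
  · rw [norm_mul, norm_mul, norm_mul, Complex.norm_exp_ofReal_mul_I, one_mul,
      mulS_apply (temperate_bracket s), norm_mul]
    have h1 := (hT ξ t).trans (mul_le_mul_of_nonneg_left (hB (ξ - t • unitVec j))
      (by positivity : 0 ≤ C * (1 + |t|) ^ A))
    calc _ ≤ ‖𝓕 ψ t‖ * (C * (1 + |t|) ^ A * (C' * ‖bracket s (ξ - t • unitVec j)‖) *
          ‖w (ξ - t • unitVec j)‖) := by gcongr
      _ = _ := by simp only [k]; ring

/-- A Schwartz function that is the identity on `(-ρ, ρ)` and bounded by `2ρ`. -/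
theorem exists_ramp {ρ : ℝ} (hρ : 0 < ρ) :
    ∃ ψ : 𝓢(ℝ, ℂ), (∀ t, |t| < ρ → ψ t = t) ∧ ∀ t, ‖ψ t‖ ≤ 2 * ρ := by
  let χ : ContDiffBump (0 : ℝ) := ⟨ρ, 2 * ρ, hρ, by linarith⟩
  have h1 : HasCompactSupport fun t : ℝ ↦ ((t * χ t : ℝ) : ℂ) :=
    (χ.hasCompactSupport.mul_left (f := fun t : ℝ ↦ t)).comp_left (g := Complex.ofReal) rfl
  have h2 : ContDiff ℝ ∞ fun t : ℝ ↦ ((t * χ t : ℝ) : ℂ) :=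
    Complex.ofRealCLM.contDiff.comp (contDiff_id.mul χ.contDiff)
  refine ⟨h1.toSchwartzMap h2, fun t ht ↦ ?_, fun t ↦ ?_⟩
  · rw [HasCompactSupport.toSchwartzMap_toFun, χ.one_of_mem_closedBall, mul_one]
    simpa [χ] using ht.le
  · rw [HasCompactSupport.toSchwartzMap_toFun, Complex.norm_real, norm_mul]
    by_cases ht : |t| < 2 * ρ
    · rw [Real.norm_of_nonneg χ.nonneg, Real.norm_eq_abs]
      nlinarith [χ.le_one (x := t), χ.nonneg (x := t), abs_nonneg t]
    · rw [χ.zero_of_le_dist (by simpa [χ] using ht)]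
      simp [hρ.le]

/-- A form of Bernstein's inequality: where `q(D)u` concentrates, up to smooth errors, near the
set `|x_j - a| < ρ` that carries `u`, the operator `x_j - a` has norm at most `2ρ`. On the Fourier
side, the left-hand side is a multiple of `(∂_j + 2πi a)(q û)`, written without derivatives of
`û`. -/
theorem l2_bernstein {j : Fin n} {m : ℝ} {q : E n → ℂ} (hq : ∀ K, DirSymbol j K m q) (s : ℝ)
    {ρ : ℝ} {ψ : 𝓢(ℝ, ℂ)} (hψ : ∀ t, |t| < ρ → ψ t = t) (hψ' : ∀ t, ‖ψ t‖ ≤ 2 * ρ) :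
    ∃ c : ℝ, 0 ≤ c ∧ ∀ (u : 𝓢(E n, ℂ)) (a : ℝ), (∀ x, u x ≠ 0 → |x j - a| < ρ) →
      l2 (mulS q (𝓕 (cutoff j ψ a u)) + kap • mulS (pderiv j q) (𝓕 u)) ≤
        2 * ρ * l2 (mulS q (𝓕 u)) + c * l2 (mulS (bracket s) (𝓕 u)) := by
  let N := ⌈m - s⌉₊ + 2
  have hN : m - N ≤ s := by
    have := Nat.le_ceil (m - s)
    simp only [N]
    push_cast
    linarith
  obtain ⟨c, hc, h⟩ := l2_commutator_le hq hN ψ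
  refine ⟨c, hc, fun u a hu ↦ ?_⟩
  have hd1 : ∀ t, |t| < ρ → derivS 1 ψ t = 1 := by
    intro t ht
    have he : ⇑ψ =ᶠ[nhds t] fun t ↦ (t : ℂ) := by
      filter_upwards [(isOpen_lt continuous_abs continuous_const).mem_nhds ht] with y hy
      exact hψ y hy
    have : deriv ψ t = 1 := by
      rw [he.deriv_eq]
      exact Complex.ofRealCLM.hasDerivAt.deriv
    exact this
  have hd2 : ∀ k, ∀ t, |t| < ρ → derivS (k + 2) ψ t = 0 := by
    intro k
    induction k with
    | zero =>
      intro t ht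
      have he : ⇑(derivS 1 ψ) =ᶠ[nhds t] fun t ↦ 1 := by
        filter_upwards [(isOpen_lt continuous_abs continuous_const).mem_nhds ht] with y hy
        exact hd1 y hy
      have : deriv (derivS 1 ψ) t = 0 := by rw [he.deriv_eq]; simp
      exact this
    | succ k ih =>
      intro t ht
      have he : ⇑(derivS (k + 2) ψ) =ᶠ[nhds t] fun t ↦ 0 := by
        filter_upwards [(isOpen_lt continuous_abs continuous_const).mem_nhds ht] with y hy
        exact ih y hy
      have : deriv (derivS (k + 2) ψ) t = 0 := by rw [he.deriv_eq]; simp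
      rw [derivS, Function.iterate_succ_apply']
      exact this
  have hc1 : cutoff j (derivS 1 ψ) a u = u := by
    ext x
    rw [cutoff_apply]
    by_cases hx : u x = 0
    · simp [hx]
    · rw [hd1 _ (hu x hx), one_mul]
  have hc2 : ∀ k, cutoff j (derivS (k + 2) ψ) a u = 0 := by
    intro k
    ext x
    rw [cutoff_apply]
    by_cases hx : u x = 0
    · simp [hx]
    · rw [hd2 _ _ (hu x hx), zero_mul]; rfl
  have hF : 𝓕 (0 : 𝓢(E n, ℂ)) = 0 := map_zero (FourierTransform.fourierCLM ℂ 𝓢(E n, ℂ))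
  have h' := h u a
  rw [show N = ⌈m - s⌉₊ + 1 + 1 from rfl, Finset.sum_range_succ', Finset.sum_range_succ',
    Finset.sum_eq_zero (fun k _ ↦ by rw [hc2, hF, map_zero, smul_zero]), zero_add, hc1] at h'
  simp only [zero_add, pow_one, Nat.factorial_one, Nat.cast_one, div_one, Function.iterate_one,
    pow_zero, Nat.factorial_zero, Function.iterate_zero, id, one_smul] at h'
  have h1 : l2 (𝓕 (cutoff j ψ a (𝓕⁻ (mulS q (𝓕 u))))) ≤ 2 * ρ * l2 (mulS q (𝓕 u)) := by
    rw [l2_fourier]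
    conv_rhs => rw [← FourierTransform.fourier_fourierInv_eq (F := 𝓢(E n, ℂ)) (mulS q (𝓕 u)),
      l2_fourier]
    refine l2_le_mul fun x ↦ ?_
    rw [cutoff_apply, norm_mul]
    exact mul_le_mul_of_nonneg_right (hψ' _) (norm_nonneg _)
  set F := 𝓕 (cutoff j ψ a (𝓕⁻ (mulS q (𝓕 u))))
  set G := mulS q (𝓕 (cutoff j ψ a u)) + kap • mulS (pderiv j q) (𝓕 u) with hG
  rw [add_comm, show derivS 0 ψ = ψ from rfl, ← hG] at h'
  have h2 : G = F + (-1 : ℂ) • (F - G) := by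
    rw [neg_smul, one_smul]; abel
  rw [h2]
  refine (l2_add_le _ _).trans (add_le_add h1 ?_)
  rw [l2_smul]
  simpa using h'

end Commutator

/-! ### Hörmander's inequality for one derivative -/

section OneDerivative

variable {n : ℕ}

/-- The energy identity behind Hörmander's inequality, estimated by Cauchy--Schwarz. With
`G₀ = q W + κ (∂_j q) w` and `G₁ = \bar{∂_j q} W + κ \bar{∂_j² q} w`, one has
`κ ‖(∂_j q) w‖² = ⟪(∂_j q) w, G₀⟫ - ⟪\bar q w, G₁⟫ + κ ⟪\bar q w, \bar{∂_j² q} w⟫`. -/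
theorem l2_energy_le {j : Fin n} {q : E n → ℂ} (hq : q.HasTemperateGrowth) (w W : 𝓢(E n, ℂ)) :
    ‖kap‖ * l2 (mulS (pderiv j q) w) ^ 2 ≤
      l2 (mulS (pderiv j q) w) * l2 (mulS q W + kap • mulS (pderiv j q) w) +
      l2 (mulS q w) * l2 (mulS (fun ξ ↦ starRingEnd ℂ (pderiv j q ξ)) W +
        kap • mulS (pderiv j fun ξ ↦ starRingEnd ℂ (pderiv j q ξ)) w) +
      ‖kap‖ * (l2 (mulS q w) * l2 (mulS (pderiv j (pderiv j q)) w)) := by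
  have conj_temp : ∀ {r : E n → ℂ}, r.HasTemperateGrowth →
      (fun ξ ↦ starRingEnd ℂ (r ξ)).HasTemperateGrowth := fun h ↦
    (Complex.conjCLE : ℂ →L[ℝ] ℂ).hasTemperateGrowth.comp h
  have hq1 := temperate_pderiv hq j
  have hq2 := temperate_pderiv hq1 j
  rw [pderiv_conj hq1]
  set x := mulS (pderiv j q) w with hx
  set G0 := mulS q W + kap • x with hG0
  set y := mulS (fun ξ ↦ starRingEnd ℂ (q ξ)) w with hy
  set z := mulS (fun ξ ↦ starRingEnd ℂ (pderiv j (pderiv j q) ξ)) w with hz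
  set G1 := mulS (fun ξ ↦ starRingEnd ℂ (pderiv j q ξ)) W + kap • z with hG1
  have hyn : l2 y = l2 (mulS q w) :=
    le_antisymm (l2_le fun ξ ↦ by simp [hy, mulS_apply hq, mulS_apply (conj_temp hq)])
      (l2_le fun ξ ↦ by simp [hy, mulS_apply hq, mulS_apply (conj_temp hq)])
  have hzn : l2 z = l2 (mulS (pderiv j (pderiv j q)) w) :=
    le_antisymm (l2_le fun ξ ↦ by simp [hz, mulS_apply hq2, mulS_apply (conj_temp hq2)])
      (l2_le fun ξ ↦ by simp [hz, mulS_apply hq2, mulS_apply (conj_temp hq2)])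
  have hsw : inner ℂ (x.toLp 2 volume) ((mulS q W).toLp 2 volume) =
      inner ℂ (y.toLp 2 volume)
        ((mulS (fun ξ ↦ starRingEnd ℂ (pderiv j q ξ)) W).toLp 2 volume) := by
    refine inner_toLp_congr fun ξ ↦ ?_
    rw [hx, hy, mulS_apply hq, mulS_apply hq1, mulS_apply (conj_temp hq),
      mulS_apply (conj_temp hq1)]
    simp only [map_mul, Complex.conj_conj]
    ring
  have e0 : inner ℂ (x.toLp 2 volume) (G0.toLp 2 volume) =
      inner ℂ (x.toLp 2 volume) ((mulS q W).toLp 2 volume) +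
        kap * inner ℂ (x.toLp 2 volume) (x.toLp 2 volume) := by
    rw [hG0, toLp_add, toLp_smul, inner_add_right, inner_smul_right]
  have e1 : inner ℂ (y.toLp 2 volume) (G1.toLp 2 volume) =
      inner ℂ (y.toLp 2 volume)
        ((mulS (fun ξ ↦ starRingEnd ℂ (pderiv j q ξ)) W).toLp 2 volume) +
        kap * inner ℂ (y.toLp 2 volume) (z.toLp 2 volume) := by
    rw [hG1, toLp_add, toLp_smul, inner_add_right, inner_smul_right]
  have key : kap * inner ℂ (x.toLp 2 volume) (x.toLp 2 volume) =
      inner ℂ (x.toLp 2 volume) (G0.toLp 2 volume) -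
      inner ℂ (y.toLp 2 volume) (G1.toLp 2 volume) +
      kap * inner ℂ (y.toLp 2 volume) (z.toLp 2 volume) := by
    rw [e0, e1, hsw]; ring
  have cs : ∀ f g : 𝓢(E n, ℂ), ‖inner ℂ (f.toLp 2 volume) (g.toLp 2 volume)‖ ≤ l2 f * l2 g :=
    fun f g ↦ norm_inner_le_norm _ _
  have hxx : ‖inner ℂ (x.toLp 2 volume) (x.toLp 2 volume)‖ = l2 x ^ 2 := by
    rw [inner_self_eq_norm_sq_to_K]
    simp [l2]
  rw [← hyn, ← hzn, ← hxx, ← norm_mul, key]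
  refine (norm_add_le _ _).trans (add_le_add ((norm_sub_le _ _).trans
    (add_le_add (cs _ _) (cs _ _))) ?_)
  rw [norm_mul]
  exact mul_le_mul_of_nonneg_left (cs _ _) (norm_nonneg _)

/-- Absorption: either `X ≤ δ A`, or `A < X / δ` and one factor `X` cancels. -/
theorem le_of_sq_le {X A r δ c : ℝ} (hA : 0 ≤ A) (hr : 0 ≤ r) (hδ : 0 < δ)
    (hc : 0 ≤ c) (h : X ^ 2 ≤ δ / 2 * A * X + c * r * X + c * r * A) :
    X ≤ δ * A + (c + c / δ) * r := by
  by_cases hXA : X ≤ δ * A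
  · have : 0 ≤ (c + c / δ) * r := by positivity
    linarith
  · push Not at hXA
    have hX0 : 0 < X := lt_of_le_of_lt (by positivity) hXA
    have h1 : c * r * A ≤ c / δ * r * X := by
      have : c / δ * r * X - c * r * A = c * r / δ * (X - δ * A) := by field_simp
      have : 0 ≤ c * r / δ * (X - δ * A) := mul_nonneg (by positivity) (by linarith)
      linarith
    have h2 : X * X ≤ (δ / 2 * A + (c + c / δ) * r) * X := by nlinarith
    have h3 := le_of_mul_le_mul_right h2 hX0
    have : 0 ≤ δ * A := by positivity
    linarith

/-- Hörmander's inequality in `L²`, for one derivative. The induction is on the number of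
derivatives after which the order of the symbol has dropped to `s`. -/
theorem l2_pderiv_le {j : Fin n} {s : ℝ} (N : ℕ) {m : ℝ} {q : E n → ℂ}
    (hq : ∀ K, DirSymbol j K m q) (hN : m - N ≤ s) {δ : ℝ} (hδ : 0 < δ) :
    ∃ ρ : ℝ, 0 < ρ ∧ ∃ c : ℝ, 0 ≤ c ∧ ∀ (u : 𝓢(E n, ℂ)) (a : ℝ),
      (∀ x, u x ≠ 0 → |x j - a| < ρ) →
      l2 (mulS (pderiv j q) (𝓕 u)) ≤
        δ * l2 (mulS q (𝓕 u)) + c * l2 (mulS (bracket s) (𝓕 u)) := by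
  induction N generalizing m q δ with
  | zero =>
    obtain ⟨C, hC, h⟩ := (((hq 1).2).mono (m' := s) (by simp at hN; linarith)).bound
    obtain ⟨C', hC', h'⟩ := le_norm_bracket (n := n) s
    refine ⟨1, one_pos, C * C', by positivity, fun u a _ ↦ ?_⟩
    have : l2 (mulS (pderiv j q) (𝓕 u)) ≤ C * C' * l2 (mulS (bracket s) (𝓕 u)) := by
      refine l2_le_mul fun ξ ↦ ?_
      rw [mulS_apply (hq 1).2.temperate, mulS_apply (temperate_bracket s), norm_mul, norm_mul,
        ← mul_assoc]
      gcongr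
      refine (h ξ).trans ?_
      rw [mul_assoc]
      gcongr
      exact h' ξ
    have h0 : 0 ≤ δ * l2 (mulS q (𝓕 u)) := mul_nonneg hδ.le (l2_nonneg _)
    linarith
  | succ N ih =>
    have hq1 : ∀ K, DirSymbol j K (m - 1) (pderiv j q) := fun K ↦ (hq (K + 1)).2
    obtain ⟨ρ₁, hρ₁, c₁, hc₁, h₁⟩ := ih hq1 (by push_cast at hN; linarith)
      (show 0 < δ / 4 by positivity)
    -- This `ρ` and the `δ / 4` above bring the coefficient of `A X` below `δ / 2` in `le_of_sq_le`.
    let ρ := min ρ₁ (δ / (32 * Real.pi))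
    have hρ : 0 < ρ := lt_min hρ₁ (by positivity)
    obtain ⟨ψ, hψ, hψ'⟩ := exists_ramp hρ
    obtain ⟨c₂, hc₂, h₂⟩ := l2_bernstein hq s hψ hψ'
    obtain ⟨c₃, hc₃, h₃⟩ := l2_bernstein (fun K ↦ (hq1 K).conj) s hψ hψ'
    let c := 2 * Real.pi * (c₂ + c₃) + c₁
    have hc : 0 ≤ c := by positivity
    refine ⟨ρ, hρ, c + c / δ, by positivity, fun u a hu ↦ ?_⟩
    have b₁ := h₁ u a fun x hx ↦ (hu x hx).trans_le (min_le_left _ _)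
    have b₂ := h₂ u a hu
    have b₃ := h₃ u a hu
    have hen := l2_energy_le (j := j) (hq 0).temperate (𝓕 u) (𝓕 (cutoff j ψ a u))
    have hcj : l2 (mulS (fun ξ ↦ starRingEnd ℂ (pderiv j q ξ)) (𝓕 u)) ≤
        l2 (mulS (pderiv j q) (𝓕 u)) := l2_le fun ξ ↦ by
      rw [mulS_apply (hq1 0).temperate, mulS_apply (hq1 0).conj.temperate]
      simp
    have hX := l2_nonneg (mulS (pderiv j q) (𝓕 u))
    have hA := l2_nonneg (mulS q (𝓕 u))
    have hr := l2_nonneg (mulS (bracket s) (𝓕 u))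
    refine le_of_sq_le hA hr hδ hc ?_
    have hρ' : 2 * Real.pi * (4 * ρ) ≤ δ / 4 := by
      have : ρ ≤ δ / (32 * Real.pi) := min_le_right _ _
      rw [le_div_iff₀ (by positivity)] at this
      linarith
    generalize l2 (mulS (pderiv j q) (𝓕 u)) = X at *
    generalize l2 (mulS q (𝓕 u)) = A at *
    generalize l2 (mulS (bracket s) (𝓕 u)) = r at *
    have hpi := Real.pi_pos
    have hen' : X ^ 2 ≤ 2 * Real.pi * (X * (2 * ρ * A + c₂ * r) + A * (2 * ρ * X + c₃ * r)) +
        A * (δ / 4 * X + c₁ * r) := by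
      have t₁ := mul_le_mul_of_nonneg_left b₂ hX
      have t₂ := mul_le_mul_of_nonneg_left (b₃.trans (add_le_add_left
        (mul_le_mul_of_nonneg_left hcj (by positivity : 0 ≤ 2 * ρ)) _)) hA
      have t₃ := mul_le_mul_of_nonneg_left (mul_le_mul_of_nonneg_left b₁ hA) (norm_nonneg kap)
      have t := hen.trans (add_le_add (add_le_add t₁ t₂) t₃)
      rw [norm_kap, inv_mul_le_iff₀ (by positivity), mul_add,
        mul_inv_cancel_left₀ (by positivity)] at t
      exact t
    have k₁ := mul_le_mul_of_nonneg_right hρ' (mul_nonneg hA hX)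
    have k₂ : 0 ≤ 2 * Real.pi * c₃ * r * X + c₁ * r * X + 2 * Real.pi * c₂ * r * A := by positivity
    simp only [c]
    nlinarith

end OneDerivative

/-! ### Sobolev norms and arbitrary derivatives -/

section Sobolev

variable {n : ℕ}

theorem sobolevNorm_eq (s : ℝ) (u : 𝓢(E n, ℂ)) :
    sobolevNorm s u = l2 (mulS (dil (bracket s)) (𝓕 u)) := by
  rw [sobolevNorm, ← Real.sqrt_sq (l2_nonneg (mulS (dil (bracket s)) (𝓕 u))), l2_sq]
  congr 1
  have h := Measure.integral_comp_smul (volume : Measure (E n))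
    (fun ξ ↦ (1 + ‖ξ‖ ^ 2) ^ s * ‖ft u ξ‖ ^ 2) (2 * Real.pi)
  rw [finrank_euclideanSpace_fin, abs_of_pos (by positivity), smul_eq_mul] at h
  rw [← h]
  congr 1
  funext ξ
  rw [mulS_apply (temperate_dil (temperate_bracket s)), norm_mul, mul_pow, dil, norm_bracket,
    ft_eq, SchwartzMap.fourier_coe, ← Real.rpow_mul_natCast (by positivity)]
  norm_num

theorem sobolevNorm_psido {P : E n → ℂ} (hP : P.HasTemperateGrowth) (s : ℝ) (u : 𝓢(E n, ℂ)) :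
    sobolevNorm s (psido P u) = l2 (mulS (dil fun ξ ↦ bracket s ξ * P ξ) (𝓕 u)) := by
  have h : (fun ξ ↦ bracket s ξ * P ξ).HasTemperateGrowth := (temperate_bracket s).mul hP
  rw [sobolevNorm_eq]
  congr 1
  rw [psido, SchwartzMap.fourierMultiplierCLM_apply,
    FourierTransform.fourier_fourierInv_eq (F := 𝓢(E n, ℂ))]
  ext ξ
  rw [mulS_apply (temperate_dil (temperate_bracket s)), mulS_apply (temperate_dil h)]
  change _ * mulS (dil P) (𝓕 u) ξ = _
  rw [mulS_apply (temperate_dil hP)]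
  simp only [dil]
  ring

theorem l2_bracket_le (s : ℝ) : ∃ C : ℝ, 0 < C ∧ ∀ u : 𝓢(E n, ℂ),
    l2 (mulS (bracket s) (𝓕 u)) ≤ C * sobolevNorm s u := by
  obtain ⟨C, hC, h⟩ := norm_bracket_le (n := n) s
  obtain ⟨C', hC', h'⟩ := le_norm_bracket (n := n) s
  refine ⟨C * ((2 * Real.pi) ^ |s| * C'), by positivity, fun u ↦ ?_⟩
  rw [sobolevNorm_eq]
  refine l2_le_mul fun ξ ↦ ?_
  rw [mulS_apply (temperate_bracket s), mulS_apply (temperate_dil (temperate_bracket s)),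
    norm_mul, norm_mul, ← mul_assoc, dil]
  gcongr
  refine (h ξ).trans ?_
  rw [mul_assoc, mul_assoc]
  gcongr
  refine (le_one_add_norm_smul_rpow s ξ).trans ?_
  gcongr
  exact h' _

/-- The commutator of `∂_j` with the weight `(1 + |ξ|²)^{s/2}` is of lower order, hence as small
as one likes up to smoothing errors. -/
theorem norm_pderiv_bracket_mul_le (j : Fin n) (s s' : ℝ) {m : ℝ} {P : E n → ℂ}
    (hP : DirSymbol j 0 m P) {δ : ℝ} (hδ : 0 < δ) : ∃ C : ℝ, 0 < C ∧ ∀ ξ,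
      ‖pderiv j (bracket s) ξ * P ξ‖ ≤ δ * ‖bracket s ξ * P ξ‖ + C * ‖bracket s' ξ‖ := by
  obtain ⟨C, hC, h⟩ := ((dirSymbol_bracket j 0 s).mul hP).bound
  obtain ⟨C', hC', h'⟩ := le_norm_bracket (n := n) s'
  let L := max (2 * |s| / δ) 1
  have hL : 1 ≤ L := le_max_right _ _
  have hd : ∀ ξ : E n, ‖pderiv j (bracket s) ξ‖ ≤ 2 * |s| / (1 + ‖ξ‖) * ‖bracket s ξ‖ := by
    intro ξ
    have h0 : 0 < 1 + ‖ξ‖ := by positivity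
    have e : bracket s ξ = ((1 + ‖ξ‖ ^ 2 : ℝ) : ℂ) * bracket (s - 2) ξ := by
      conv_lhs => rw [← add_sub_cancel 2 s, bracket_add]
      congr 1
      simp [bracket]
    rw [pderiv_bracket, e]
    simp only [norm_mul, Complex.norm_real]
    rw [Real.norm_of_nonneg (by positivity : (0 : ℝ) ≤ 1 + ‖ξ‖ ^ 2), Real.norm_eq_abs,
      ← mul_assoc, ← mul_assoc]
    refine mul_le_mul_of_nonneg_right ?_ (norm_nonneg _)
    rw [div_mul_eq_mul_div, le_div_iff₀ h0, mul_comm 2 |s|, mul_assoc, mul_assoc]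
    refine mul_le_mul_of_nonneg_left ?_ (abs_nonneg s)
    have := PiLp.norm_apply_le ξ j
    nlinarith [norm_nonneg ξ, sq_nonneg (‖ξ‖ - 1)]
  refine ⟨2 * |s| * C * L ^ |s + m - s'| * C' + 1, by positivity, fun ξ ↦ ?_⟩
  rw [norm_mul]
  have h0 : 0 < 1 + ‖ξ‖ := by positivity
  have h1 : ‖pderiv j (bracket s) ξ‖ * ‖P ξ‖ ≤ 2 * |s| / (1 + ‖ξ‖) * ‖bracket s ξ * P ξ‖ := by
    rw [norm_mul, ← mul_assoc]
    exact mul_le_mul_of_nonneg_right (hd ξ) (norm_nonneg _)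
  refine h1.trans ?_
  -- High frequencies are absorbed by `δ`, low ones by the weight of order `s'`.
  by_cases hξ : 2 * |s| / (1 + ‖ξ‖) ≤ δ
  · have : 0 ≤ (2 * |s| * C * L ^ |s + m - s'| * C' + 1) * ‖bracket s' ξ‖ := by positivity
    exact (mul_le_mul_of_nonneg_right hξ (norm_nonneg _)).trans (by linarith)
  · have hξ' : 1 + ‖ξ‖ ≤ L := by
      push Not at hξ
      rw [lt_div_iff₀ h0] at hξ
      refine le_trans ?_ (le_max_left _ _)
      rw [le_div_iff₀ hδ]
      linarith
    have h2 : (1 + ‖ξ‖) ^ (s + m) ≤ L ^ |s + m - s'| * (1 + ‖ξ‖) ^ s' := by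
      have := rpow_le_rpow_abs_mul_rpow h0 one_pos hL (by linarith)
        (by nlinarith [norm_nonneg ξ]) (s + m - s')
      rw [Real.one_rpow, mul_one] at this
      calc (1 + ‖ξ‖) ^ (s + m) = (1 + ‖ξ‖) ^ (s + m - s') * (1 + ‖ξ‖) ^ s' := by
            rw [← Real.rpow_add h0]; congr 1; ring
        _ ≤ _ := by gcongr
    have h3 : 2 * |s| / (1 + ‖ξ‖) ≤ 2 * |s| :=
      div_le_self (by positivity) (by linarith [norm_nonneg ξ])
    calc 2 * |s| / (1 + ‖ξ‖) * ‖bracket s ξ * P ξ‖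
        ≤ 2 * |s| * (C * (L ^ |s + m - s'| * (C' * ‖bracket s' ξ‖))) := by
          gcongr
          refine (h ξ).trans ?_
          gcongr
          refine h2.trans ?_
          gcongr
          exact h' ξ
      _ = 2 * |s| * C * L ^ |s + m - s'| * C' * ‖bracket s' ξ‖ := by ring
      _ ≤ _ := by
          have h4 := norm_nonneg (bracket s' ξ)
          have h5 : 0 ≤ δ * ‖bracket s ξ * P ξ‖ := by positivity
          linarith

theorem sobolevNorm_pderiv_le (j : Fin n) {m : ℝ} {P : E n → ℂ} (hP : IsSymbol m P) (s s' : ℝ)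
    {δ : ℝ} (hδ : 0 < δ) : ∃ ρ : ℝ, 0 < ρ ∧ ∃ c : ℝ, 0 < c ∧ ∀ (u : 𝓢(E n, ℂ)) (x₀ : E n),
      (∀ x, u x ≠ 0 → dist x x₀ < ρ) →
      sobolevNorm s (psido (pderiv j P) u) ≤
        δ * sobolevNorm s (psido P u) + c * sobolevNorm s' u := by
  let R : E n → ℂ := fun ξ ↦ bracket s ξ * P ξ
  have hR : ∀ K, DirSymbol j K (s + m) R := fun K ↦ (dirSymbol_bracket j K s).mul (hP.dirSymbol j K)
  have hPt := hP.hasTemperateGrowth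
  have hRt := (hR 0).temperate
  obtain ⟨ρ, hρ, c, hc, h⟩ := l2_pderiv_le (s := s') ⌈s + m - s'⌉₊ (fun K ↦ (hR K).dil)
    (by linarith [Nat.le_ceil (s + m - s')]) (half_pos hδ)
  obtain ⟨C₁, hC₁, h₁⟩ := norm_pderiv_bracket_mul_le j s s' (hP.dirSymbol j 0) (half_pos hδ)
  obtain ⟨C₂, hC₂, h₂⟩ := l2_bracket_le (n := n) s'
  refine ⟨ρ, hρ, c * C₂ + C₁, by positivity, fun u x₀ hu ↦ ?_⟩
  have hd := h u (x₀ j) fun x hx ↦ by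
    refine lt_of_le_of_lt ?_ (hu x hx)
    rw [dist_eq_norm]
    exact PiLp.norm_apply_le (x - x₀) j
  have hpi : (1 : ℝ) ≤ 2 * Real.pi := by linarith [Real.pi_gt_three]
  have hPjt := temperate_pderiv hPt j
  have hsPj : (fun ξ ↦ bracket s ξ * pderiv j P ξ).HasTemperateGrowth :=
    (temperate_bracket s).mul hPjt
  rw [sobolevNorm_psido hPt, sobolevNorm_psido hPjt]
  set f := mulS (dil fun ξ ↦ bracket s ξ * pderiv j P ξ) (𝓕 u) with hf
  set g := mulS (dil (pderiv j R)) (𝓕 u) with hg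
  have hgl : l2 g ≤ l2 (mulS (pderiv j (dil R)) (𝓕 u)) := by
    refine l2_le fun ξ ↦ ?_
    rw [hg, mulS_apply (temperate_dil (temperate_pderiv hRt j)),
      mulS_apply (temperate_pderiv (temperate_dil hRt) j), pderiv_dil hRt, mul_assoc,
      norm_mul ((2 * Real.pi : ℝ) : ℂ), Complex.norm_real, Real.norm_of_nonneg (by positivity)]
    exact le_mul_of_one_le_left (norm_nonneg _) hpi
  have hfg : l2 (f + (-1 : ℂ) • g) ≤
      δ / 2 * l2 (mulS (dil R) (𝓕 u)) + C₁ * l2 (mulS (dil (bracket s')) (𝓕 u)) := by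
    refine l2_le_add (by positivity) hC₁.le fun ξ ↦ ?_
    have e : (f + (-1 : ℂ) • g) ξ =
        -(dil (fun ξ ↦ pderiv j (bracket s) ξ * P ξ) ξ * 𝓕 u ξ) := by
      rw [add_apply, smul_apply, hf, hg, mulS_apply (temperate_dil (temperate_pderiv hRt j)),
        mulS_apply (temperate_dil hsPj),
        pderiv_mul (temperate_bracket s) hPt]
      simp only [dil, smul_eq_mul]
      ring
    rw [e, norm_neg, mulS_apply (temperate_dil hRt),
      mulS_apply (temperate_dil (temperate_bracket s')), norm_mul, norm_mul, norm_mul,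
      ← mul_assoc, ← mul_assoc, ← add_mul]
    exact mul_le_mul_of_nonneg_right (h₁ _) (norm_nonneg _)
  rw [← sobolevNorm_eq] at hfg
  have hfs : f = (f + (-1 : ℂ) • g) + g := by rw [neg_smul, one_smul]; abel
  have ht := l2_add_le (f + (-1 : ℂ) • g) g
  rw [← hfs] at ht
  have hu2 := mul_le_mul_of_nonneg_left (h₂ u) hc
  linarith

theorem sobolevNorm_multiDeriv_le {m : ℝ} {P : E n → ℂ} (hP : IsSymbol m P) {α : Fin n → ℕ}
    (hα : α ≠ 0) (s s' : ℝ) {δ : ℝ} (hδ : 0 < δ) :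
    ∃ ρ : ℝ, 0 < ρ ∧ ∃ c : ℝ, 0 < c ∧ ∀ (u : 𝓢(E n, ℂ)) (x₀ : E n),
      (∀ x, u x ≠ 0 → dist x x₀ < ρ) →
      sobolevNorm s (psido (multiDeriv α P) u) ≤
        δ * sobolevNorm s (psido P u) + c * sobolevNorm s' u := by
  induction hk : ∑ j, α j generalizing α with
  | zero =>
    exact absurd (funext fun j ↦ Finset.sum_eq_zero_iff.1 hk j (Finset.mem_univ j)) hα
  | succ k ih =>
    obtain ⟨i, hi⟩ := Function.ne_iff.1 hα
    obtain ⟨β, rfl⟩ : ∃ β : Fin n → ℕ, α = β + Pi.single i 1 := by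
      refine ⟨α - Pi.single i 1, (tsub_add_cancel_of_le ?_).symm⟩
      intro l
      rcases eq_or_ne l i with rfl | h
      · simpa using Nat.one_le_iff_ne_zero.2 hi
      · simp [Pi.single_eq_of_ne h]
    rw [← pderiv_multiDeriv hP.1]
    by_cases hβ : β = 0
    · subst hβ
      rw [multiDeriv_zero]
      exact sobolevNorm_pderiv_le i hP s s' hδ
    · have hβk : ∑ j, β j = k := by
        simpa [Finset.sum_add_distrib, Pi.single_apply] using hk
      obtain ⟨ρ₁, hρ₁, c₁, hc₁, h₁⟩ := ih hβ hβk
      obtain ⟨ρ₂, hρ₂, c₂, hc₂, h₂⟩ := sobolevNorm_pderiv_le i (hP.multiDeriv β) s s' one_pos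
      refine ⟨min ρ₁ ρ₂, lt_min hρ₁ hρ₂, c₁ + c₂, by positivity, fun u x₀ hu ↦ ?_⟩
      have b₁ := h₁ u x₀ fun x hx ↦ (hu x hx).trans_le (min_le_left _ _)
      have b₂ := h₂ u x₀ fun x hx ↦ (hu x hx).trans_le (min_le_right _ _)
      linarith

/-- A set of small diameter lies in a ball around any of its points; for `u = 0` any centre will
do. -/
theorem IsTest.exists_center {Ω : Set (E n)} {ρ : ℝ}
    (hΩ : Metric.ediam Ω < ENNReal.ofReal ρ) {u : 𝓢(E n, ℂ)} (hu : IsTest Ω u) :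
    ∃ x₀, ∀ x, u x ≠ 0 → dist x x₀ < ρ := by
  have hmem : ∀ x, u x ≠ 0 → x ∈ Ω := fun x hx ↦ hu.2 (subset_tsupport _ hx)
  by_cases h : ∃ x₀, u x₀ ≠ 0
  · obtain ⟨x₀, h₀⟩ := h
    refine ⟨x₀, fun x hx ↦ ?_⟩
    have := (Metric.edist_le_ediam_of_mem (hmem x hx) (hmem x₀ h₀)).trans_lt hΩ
    rwa [edist_dist, ENNReal.ofReal_lt_ofReal_iff_of_nonneg dist_nonneg] at this
  · push Not at h
    exact ⟨0, fun x hx ↦ absurd (h x) hx⟩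

end Sobolev

end HormanderIneq

end

open HormanderIneq in
theorem theorem1 (n : ℕ) (m : ℝ) (P : E n → ℂ) (hP : IsSymbol m P)
    (α : Fin n → ℕ) (hα : α ≠ 0) :
    (∀ s θ : ℝ, 1 ≤ θ → ∀ δ : ℝ, 0 < δ → ∃ ρ : ℝ, 0 < ρ ∧ ∃ c : ℝ, 0 < c ∧
      ∀ Ω : Set (E n), IsOpen Ω → Metric.ediam Ω < ENNReal.ofReal ρ →
        ∀ u : 𝓢(E n, ℂ), IsTest Ω u →
          sobolevNorm s (psido (multiDeriv α P) u) ≤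
            δ * sobolevNorm s (psido P u) + c * sobolevNorm (s + m - θ) u) ∧
    (∀ s s' : ℝ, s' < s + m - ((∑ j, α j : ℕ) : ℝ) → ∀ δ : ℝ, 0 < δ →
      ∃ ρ : ℝ, 0 < ρ ∧ ∃ c : ℝ, 0 < c ∧
      ∀ Ω : Set (E n), IsOpen Ω → Metric.ediam Ω < ENNReal.ofReal ρ →
        ∀ u : 𝓢(E n, ℂ), IsTest Ω u →
          sobolevNorm s (psido (multiDeriv α P) u) ≤
            δ * sobolevNorm s (psido P u) + c * sobolevNorm s' u) := by
  have main : ∀ s s' δ : ℝ, 0 < δ → ∃ ρ : ℝ, 0 < ρ ∧ ∃ c : ℝ, 0 < c ∧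
      ∀ Ω : Set (E n), IsOpen Ω → Metric.ediam Ω < ENNReal.ofReal ρ →
        ∀ u : 𝓢(E n, ℂ), IsTest Ω u →
          sobolevNorm s (psido (multiDeriv α P) u) ≤
            δ * sobolevNorm s (psido P u) + c * sobolevNorm s' u := by
    intro s s' δ hδ
    obtain ⟨ρ, hρ, c, hc, h⟩ := sobolevNorm_multiDeriv_le hP hα s s' hδ
    refine ⟨ρ, hρ, c, hc, fun Ω _ hΩ u hu ↦ ?_⟩
    obtain ⟨x₀, hx₀⟩ := hu.exists_center hΩ
    exact h u x₀ hx₀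
  exact ⟨fun s θ _ δ hδ ↦ main s (s + m - θ) δ hδ, fun s s' _ δ hδ ↦ main s s' δ hδ⟩
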